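/- Let $R$ be a commutative ring, $H$ a Hopf algebra over $R$ and $C$, $D$ coalgebras over $R$ with (right) coactions of $H$: $H$-comodule structures $\delta(c)=c^{(0)}\otimes c^{(1)}$ with $c_{(1)}^{(0)}\otimes c_{(2)}^{(0)}\otimes c_{(1)}^{(1)}c_{(2)}^{(1)}=(c^{(0)})_{(1)}\otimes (c^{(0)})_{(2)}\otimes c^{(1)}$ and $\varepsilon(c^{(0)})\varepsilon(c^{(1)})=\varepsilon(c)$. *Equivariant (bi)comodules.* An $H$-equivariant right $C$-comodule is a right $C$-comodule $M$ with an $H$-comodule structure $\delta:M\to M\otimes H$ such that $(m^{(0)})_{(0)}\otimes (m^{(0)})_{(1)}\otimes m^{(1)}=m_{(0)}^{(0)}\otimes m_{(1)}^{(0)}\otimes m_{(0)}^{(1)}m_{(1)}^{(1)}$; likewise on the left. Morphisms are maps colinear over the coalgebra and over $H$. An $H$-equivariant $(D,C)$-bicomodule $(M,\delta)$ is a $(D,C)$-bicomodule $M$ (left over $D$, right over $C$) with a $\delta$ making it $H$-equivariant on both sides. *Morita-Takeuchi.* An $H$-equivariant $(D,C)$-bicomodule $(M,\delta)$ is an $H$-equivariant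 Morita-Takeuchi bicomodule if (a) it is quasi-finite: the functor $M\,\square_C-$ from $H$-equivariant left $C$-comodules to $H$-equivariant left $D$-comodules ($H$ coacting diagonally) has a left adjoint $\mathrm{CoHom}_H(M,-)$, i.e. for each $H$-equivariant left $D$-comodule $Y$ there are an $X=\mathrm{CoHom}_H(M,Y)$ and a universal map $Y\to M\,\square_C X$; here a morphism $Y\to M\,\square_C Z$ means a $D$- and $H$-colinear map $Y\to M\otimes Z$ with values in the equalizer $M\,\square_C Z$; (b) it is faithfully coflat over $D$: the functor $-\,\square_D M$ from $H$-equivariant right $D$-comodules to $R$-modules is exact and faithful; (c) it is an injector: $\mathrm{CoHom}_H(M,-)$ is exact; (d) $\mathrm{CoEnd}_H(M)\cong C$ naturally: the canonical map $\mathrm{CoHom}_H(M,M)\to C$ induced by the right $C$-comodule structure of $M$ is bijective. (Exact means: preserving short sequences that are exact as sequences of $R$-modules.) *Homoschism group.* Let $\Gamma(C\circlearrowright H)$ be the group, under convolution $*$, of the convolution invertible $\varphi\in\mathrm{Hom}_R(C,H)$ with $\varepsilon_H\circ\varphi=\varepsilon_C$, $\ \Delta_H(\varphi(c))=\varphi(c_{(1)}^{(0)})\otimes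 c_{(1)}^{(1)}\varphi(c_{(2)})$ and $c_{(1)}^{(0)}\otimes c_{(1)}^{(1)}\varphi(c_{(2)})=c_{(2)}^{(0)}\otimes\varphi(c_{(1)})c_{(2)}^{(1)}$. Its elements of the form $c\mapsto f(c_{(1)}^{(0)})\,c_{(1)}^{(1)}\,f^{*-1}(c_{(2)})$, where $f:C\to R$ is a convolution invertible functional that is cocentral ($f(c_{(1)})c_{(2)}=f(c_{(2)})c_{(1)}$), form a normal subgroup, the inner cocharacters. The first homoschism group $S^1(H,C)$ is the quotient of $\Gamma(C\circlearrowright H)$ by it. **Proposition.** Let $(M,\delta_0)$ be an $H$-equivariant Morita-Takeuchi $(D,C)$-bicomodule, and let $\mathcal A$ be the set of all $H$-coactions $\delta:M\to M\otimes H$ for which $(M,\delta)$ is an $H$-equivariant bicomodule. For $\varphi\in\mathrm{Hom}_R(C,H)$ put $\delta_\varphi(m)=m_{(0)}^{(0)}\otimes m_{(0)}^{(1)}\varphi(m_{(1)})$. 1. $(\varphi,\delta)\mapsto\delta_\varphi$ is a (right) action of $\Gamma(C\circlearrowright H)$ on $\mathcal A$, and this action is free and transitive. 2. Call $\delta,\delta'\in\mathcal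 A$ isomorphic if $\delta'=(u\otimes\mathrm{id})\circ\delta\circ u^{-1}$ for an automorphism $u$ of the $(D,C)$-bicomodule $M$. The action of part 1 descends to a (right) action $([\varphi],[\delta])\mapsto[\delta_\varphi]$ of $S^1(H,C)$ on the set of isomorphism classes in $\mathcal A$, and this action is free and transitive. -/

import Mathlib

open TensorProduct

universe u

namespace HopfEquivariant

noncomputable section

/-! ### Comodules -/

/-- A right comodule structure `M → M ⊗ C` over the coalgebra `C` on the `R`-module `M`. -/
@[ext]
structure RightComodule (R : Type u) [CommRing R] (C : Type u) [AddCommGroup C] [Module R C]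
    [Coalgebra R C] (M : Type u) [AddCommGroup M] [Module R M] where
  /-- The structure map. -/
  coact : M →ₗ[R] M ⊗[R] C
  coassoc : (TensorProduct.assoc R M C C).toLinearMap ∘ₗ coact.rTensor C ∘ₗ coact =
    (Coalgebra.comul (R := R) (A := C)).lTensor M ∘ₗ coact
  counit : (TensorProduct.rid R M).toLinearMap ∘ₗ
    (Coalgebra.counit (R := R) (A := C)).lTensor M ∘ₗ coact = LinearMap.id

/-- A left comodule structure `M → C ⊗ M` over the coalgebra `C` on the `R`-module `M`. -/
@[ext]
structure LeftComodule (R : Type u) [CommRing R] (C : Type u) [AddCommGroup C] [Module R C]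
    [Coalgebra R C] (M : Type u) [AddCommGroup M] [Module R M] where
  /-- The structure map. -/
  coact : M →ₗ[R] C ⊗[R] M
  coassoc : (TensorProduct.assoc R C C M).toLinearMap ∘ₗ
    (Coalgebra.comul (R := R) (A := C)).rTensor M ∘ₗ coact = coact.lTensor C ∘ₗ coact
  counit : (TensorProduct.lid R M).toLinearMap ∘ₗ
    (Coalgebra.counit (R := R) (A := C)).rTensor M ∘ₗ coact = LinearMap.id

section Modules

variable {R : Type u} [CommRing R] {C : Type u} [AddCommGroup C] [Module R C] [Coalgebra R C]
  {M : Type u} [AddCommGroup M] [Module R M] {N : Type u} [AddCommGroup N] [Module R N]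

/-- `f` is a morphism of right comodules: `f(m)₍₀₎ ⊗ f(m)₍₁₎ = f(m₍₀₎) ⊗ m₍₁₎`. -/
def RightComodule.IsHom (ρ : RightComodule R C M) (σ : RightComodule R C N)
    (f : M →ₗ[R] N) : Prop :=
  σ.coact ∘ₗ f = f.rTensor C ∘ₗ ρ.coact

/-- `f` is a morphism of left comodules. -/
def LeftComodule.IsHom (ρ : LeftComodule R C M) (σ : LeftComodule R C N)
    (f : M →ₗ[R] N) : Prop :=
  σ.coact ∘ₗ f = f.lTensor C ∘ₗ ρ.coact

end Modules

/-- For `δM : M → M ⊗ H` and `δN : N → N ⊗ H`, the diagonal map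
`m ⊗ n ↦ (m⁽⁰⁾ ⊗ n⁽⁰⁾) ⊗ m⁽¹⁾ n⁽¹⁾`. -/
def diag {R : Type u} [CommRing R] {H : Type u} [Ring H] [Algebra R H]
    {M : Type u} [AddCommGroup M] [Module R M] {N : Type u} [AddCommGroup N] [Module R N]
    (δM : M →ₗ[R] M ⊗[R] H) (δN : N →ₗ[R] N ⊗[R] H) :
    M ⊗[R] N →ₗ[R] (M ⊗[R] N) ⊗[R] H :=
  (LinearMap.mul' R H).lTensor (M ⊗[R] N) ∘ₗ
    (TensorProduct.tensorTensorTensorComm R M H N H).toLinearMap ∘ₗ TensorProduct.map δM δN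

/-! ### Coactions of Hopf algebras on coalgebras -/

/-- A (right) coaction of the Hopf algebra `H` on the coalgebra `C`: an `H`-comodule structure
`δ` on `C` which is coflat, i.e.
`c₍₁₎⁽⁰⁾ ⊗ c₍₂₎⁽⁰⁾ ⊗ c₍₁₎⁽¹⁾ c₍₂₎⁽¹⁾ = (c⁽⁰⁾)₍₁₎ ⊗ (c⁽⁰⁾)₍₂₎ ⊗ c⁽¹⁾` and
`ε(c⁽⁰⁾) ε(c⁽¹⁾) = ε(c)`. -/
structure HopfCoaction (R : Type u) [CommRing R] (H : Type u) [Ring H] [HopfAlgebra R H]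
    (C : Type u) [AddCommGroup C] [Module R C] [Coalgebra R C] extends RightComodule R H C where
  coflat : diag coact coact ∘ₗ Coalgebra.comul =
    (Coalgebra.comul (R := R) (A := C)).rTensor H ∘ₗ coact
  coflat_counit : (TensorProduct.lid R R).toLinearMap ∘ₗ
    TensorProduct.map (Coalgebra.counit (R := R) (A := C)) (Coalgebra.counit (R := R) (A := H)) ∘ₗ
      coact = Coalgebra.counit

section Coactions

open LinearMap WithConv Coalgebra

variable {R : Type u} [CommRing R] {H : Type u} [Ring H] [HopfAlgebra R H]
  {C : Type u} [AddCommGroup C] [Module R C] [Coalgebra R C]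

/-- `c ↦ g(c⁽⁰⁾) ⊗ c⁽¹⁾`, as an element of the convolution algebra `Hom(C, A ⊗ H)`. -/
def HopfCoaction.push (α : HopfCoaction R H C) {A : Type u} [Ring A] [Algebra R A]
    (g : WithConv (C →ₗ[R] A)) : WithConv (C →ₗ[R] A ⊗[R] H) :=
  toConv (g.ofConv.rTensor H ∘ₗ α.coact)

theorem HopfCoaction.push_mul (α : HopfCoaction R H C) {A : Type u} [Ring A] [Algebra R A]
    (g h : WithConv (C →ₗ[R] A)) : α.push (g * h) = α.push g * α.push h := by
  apply WithConv.ext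
  have key : (mul' R A ∘ₗ TensorProduct.map g.ofConv h.ofConv).rTensor H ∘ₗ
      ((mul' R H).lTensor (C ⊗[R] C) ∘ₗ
        (TensorProduct.tensorTensorTensorComm R C H C H).toLinearMap) =
      mul' R (A ⊗[R] H) ∘ₗ TensorProduct.map (g.ofConv.rTensor H) (h.ofConv.rTensor H) := by
    ext; simp
  ext c
  have h1 := LinearMap.congr_fun α.coflat c
  have h2 := LinearMap.congr_fun key (TensorProduct.map α.coact α.coact (comul c))
  simp only [LinearMap.comp_apply, diag] at h1 h2
  have h3 : (α.push g * α.push h).ofConv c = mul' R (A ⊗[R] H)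
      (TensorProduct.map (g.ofConv.rTensor H) (h.ofConv.rTensor H)
        (TensorProduct.map α.coact α.coact (comul c))) := by
    rw [LinearMap.convMul_def, ← LinearMap.comp_apply (TensorProduct.map _ _),
      ← TensorProduct.map_comp]
    rfl
  rw [h3, ← h2]
  erw [h1]
  rw [← LinearMap.rTensor_comp_apply]
  rfl

/-- `c ↦ 1 ⊗ φ(c)`, as a homomorphism `Hom(C, H) → Hom(C, A ⊗ H)` of convolution algebras. -/
def convIncl (R H C : Type u) [CommRing R] [Ring H] [HopfAlgebra R H] [AddCommGroup C]
    [Module R C] [Coalgebra R C] (A : Type u) [Ring A] [Algebra R A] :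
    WithConv (C →ₗ[R] H) →+* WithConv (C →ₗ[R] A ⊗[R] H) where
  toFun φ := toConv
    ((Algebra.TensorProduct.includeRight (R := R) (A := A) (B := H)).toLinearMap ∘ₗ φ.ofConv)
  map_one' := by
    apply WithConv.ext
    ext c
    simp [LinearMap.convOne_def, Algebra.algebraMap_eq_smul_one, Algebra.TensorProduct.one_def]
  map_mul' φ ψ := by
    apply WithConv.ext
    exact LinearMap.algHom_comp_convMul_distrib _ φ ψ
  map_zero' := by apply WithConv.ext; ext c; simp
  map_add' φ ψ := by apply WithConv.ext; ext c; simp [TensorProduct.tmul_add]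

/-- The axioms of a coaction force `ε(c⁽⁰⁾) c⁽¹⁾ = ε(c) 1`. -/
theorem HopfCoaction.counit_coact (α : HopfCoaction R H C) (c : C) :
    TensorProduct.lid R H ((counit (R := R) (A := C)).rTensor H (α.coact c)) =
      algebraMap R H (counit c) := by
  -- `u(c) = ε(c⁽⁰⁾) c⁽¹⁾`
  set u : C →ₗ[R] H := (TensorProduct.lid R H).toLinearMap ∘ₗ
    (counit (R := R) (A := C)).rTensor H ∘ₗ α.coact with hu
  have hΔ : comul ∘ₗ u = u.rTensor H ∘ₗ α.coact := by
    have key : ∀ z : C ⊗[R] H, comul (R := R) (TensorProduct.lid R H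
        ((counit (R := R) (A := C)).rTensor H z)) =
        ((TensorProduct.lid R H).toLinearMap ∘ₗ (counit (R := R) (A := C)).rTensor H).rTensor H
          ((TensorProduct.assoc R C H H).symm ((comul (R := R) (A := H)).lTensor C z)) := by
      intro z
      induction z with
      | zero => simp
      | add x y hx hy => simp only [map_add, hx, hy]
      | tmul c h =>
        simp only [LinearMap.rTensor_tmul, LinearMap.lTensor_tmul, TensorProduct.lid_tmul, map_smul]
        induction comul (R := R) h with
        | zero => simp
        | add x y hx hy => simp only [map_add, smul_add, TensorProduct.tmul_add, hx, hy]
        | tmul x y => simp [TensorProduct.smul_tmul']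
    ext c
    have h1 := LinearMap.congr_fun α.coassoc c
    have h2 := key (α.coact c)
    simp only [LinearMap.comp_apply, LinearEquiv.coe_coe] at h1
    rw [← h1, LinearEquiv.symm_apply_apply, ← LinearMap.rTensor_comp_apply] at h2
    exact h2
  have hε : counit ∘ₗ u = counit (R := R) (A := C) := by
    rw [← α.coflat_counit, hu]
    simp only [← LinearMap.comp_assoc]
    congr 1
    ext c h
    simp
  -- `w(c) = S(u(c⁽⁰⁾)) c⁽¹⁾ = ε(c)`
  set v : WithConv (C →ₗ[R] H) := toConv (HopfAlgebra.antipode R ∘ₗ u) with hv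
  have hw : ∀ c, mul' R H ((α.push v).ofConv c) = algebraMap R H (counit c) := by
    intro c
    have h1 := LinearMap.congr_fun (HopfAlgebra.mul_antipode_rTensor_comul (R := R) (A := H)) (u c)
    have h2 := LinearMap.congr_fun hΔ c
    have h3 := LinearMap.congr_fun hε c
    simp only [LinearMap.comp_apply] at h1 h2 h3
    rw [h2, h3, ← LinearMap.rTensor_comp_apply] at h1
    exact h1
  have hone : ∀ c, (α.push (1 : WithConv (C →ₗ[R] H))).ofConv c = (1 : H) ⊗ₜ[R] u c := by
    have key : (Algebra.linearMap R H ∘ₗ counit (R := R) (A := C)).rTensor H =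
        (Algebra.TensorProduct.includeRight (R := R) (A := H) (B := H)).toLinearMap ∘ₗ
          (TensorProduct.lid R H).toLinearMap ∘ₗ (counit (R := R) (A := C)).rTensor H := by
      ext c h
      simp [Algebra.algebraMap_eq_smul_one, TensorProduct.smul_tmul]
    intro c
    exact LinearMap.congr_fun key (α.coact c)
  have hmul : toConv (mul' R H ∘ₗ (α.push v).ofConv) * toConv u =
      toConv (mul' R H ∘ₗ (α.push v).ofConv) := by
    conv_rhs => rw [← mul_one v, α.push_mul]
    apply WithConv.ext
    ext c
    have h1 : (α.push (1 : WithConv (C →ₗ[R] H))).ofConv =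
        (Algebra.TensorProduct.includeRight (R := R) (A := H) (B := H)).toLinearMap ∘ₗ u := by
      ext c; exact hone c
    rw [LinearMap.convMul_def, LinearMap.convMul_def, h1]
    simp only [LinearMap.comp_apply]
    induction comul (R := R) c with
    | zero => simp
    | add x y hx hy => simp only [map_add, hx, hy]
    | tmul x y =>
      simp only [TensorProduct.map_tmul, LinearMap.comp_apply, mul'_apply]
      induction (α.push v).ofConv x with
      | zero => simp
      | add a b ha hb => simp only [map_add, add_mul, ha, hb]
      | tmul a b => simp [mul_assoc]
  have hw' : toConv (mul' R H ∘ₗ (α.push v).ofConv) = (1 : WithConv (C →ₗ[R] H)) := by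
    apply WithConv.ext
    ext c
    exact hw c
  rw [hw', one_mul] at hmul
  exact LinearMap.congr_fun (congrArg WithConv.ofConv hmul) c

theorem HopfCoaction.push_one (α : HopfCoaction R H C) {A : Type u} [Ring A] [Algebra R A] :
    α.push (1 : WithConv (C →ₗ[R] A)) = 1 := by
  apply WithConv.ext
  ext c
  have key : (Algebra.linearMap R A ∘ₗ counit (R := R) (A := C)).rTensor H =
      (Algebra.TensorProduct.includeRight (R := R) (A := A) (B := H)).toLinearMap ∘ₗ
        (TensorProduct.lid R H).toLinearMap ∘ₗ (counit (R := R) (A := C)).rTensor H := by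
    ext c h
    simp [Algebra.algebraMap_eq_smul_one, TensorProduct.smul_tmul]
  have h1 := LinearMap.congr_fun key (α.coact c)
  simp only [LinearMap.comp_apply, LinearEquiv.coe_coe, α.counit_coact c] at h1
  refine Eq.trans h1 ?_
  simp [LinearMap.convOne_def, Algebra.algebraMap_eq_smul_one, Algebra.TensorProduct.one_def]

/-- The equations of an equivariant cocharacter `φ : C → H`:
* `ε(φ(c)) = ε(c)`,
* `φ(c)₍₁₎ ⊗ φ(c)₍₂₎ = φ(c₍₁₎⁽⁰⁾) ⊗ c₍₁₎⁽¹⁾ φ(c₍₂₎)`,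
* `c₍₁₎⁽⁰⁾ ⊗ c₍₁₎⁽¹⁾ φ(c₍₂₎) = c₍₂₎⁽⁰⁾ ⊗ φ(c₍₁₎) c₍₂₎⁽¹⁾`. -/
structure IsCocharacter (α : HopfCoaction R H C) (φ : C →ₗ[R] H) : Prop where
  counit_comp : counit ∘ₗ φ = counit (R := R) (A := C)
  coaction : comul ∘ₗ φ = (mul' R H).lTensor H ∘ₗ (TensorProduct.assoc R H H H).toLinearMap ∘ₗ
    TensorProduct.map (φ.rTensor H ∘ₗ α.coact) φ ∘ₗ comul
  comodule : (mul' R H).lTensor C ∘ₗ (TensorProduct.assoc R C H H).toLinearMap ∘ₗ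
      TensorProduct.map α.coact φ ∘ₗ comul =
    (mul' R H).lTensor C ∘ₗ (TensorProduct.leftComm R H C H).toLinearMap ∘ₗ
      TensorProduct.map φ α.coact ∘ₗ comul

theorem push_mul_convIncl (α : HopfCoaction R H C) {A : Type u} [Ring A] [Algebra R A]
    (g : WithConv (C →ₗ[R] A)) (φ : WithConv (C →ₗ[R] H)) :
    (α.push g * convIncl R H C A φ).ofConv = g.ofConv.rTensor H ∘ₗ (mul' R H).lTensor C ∘ₗ
      (TensorProduct.assoc R C H H).toLinearMap ∘ₗ TensorProduct.map α.coact φ.ofConv ∘ₗ comul := by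
  ext c
  rw [LinearMap.convMul_def]
  simp only [LinearMap.comp_apply]
  induction comul (R := R) c with
  | zero => simp
  | add x y hx hy => simp only [map_add, hx, hy]
  | tmul x y =>
    simp only [TensorProduct.map_tmul, HopfCoaction.push, LinearMap.comp_apply, convIncl,
      RingHom.coe_mk, MonoidHom.coe_mk, OneHom.coe_mk, mul'_apply, LinearEquiv.coe_coe]
    induction α.coact x with
    | zero => simp
    | add a b ha hb => simp only [map_add, TensorProduct.add_tmul, add_mul, ha, hb]
    | tmul a b => simp

theorem convIncl_mul_push (α : HopfCoaction R H C) {A : Type u} [Ring A] [Algebra R A]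
    (g : WithConv (C →ₗ[R] A)) (φ : WithConv (C →ₗ[R] H)) :
    (convIncl R H C A φ * α.push g).ofConv = g.ofConv.rTensor H ∘ₗ (mul' R H).lTensor C ∘ₗ
      (TensorProduct.leftComm R H C H).toLinearMap ∘ₗ
        TensorProduct.map φ.ofConv α.coact ∘ₗ comul := by
  ext c
  rw [LinearMap.convMul_def]
  simp only [LinearMap.comp_apply]
  induction comul (R := R) c with
  | zero => simp
  | add x y hx hy => simp only [map_add, hx, hy]
  | tmul x y =>
    simp only [TensorProduct.map_tmul, HopfCoaction.push, LinearMap.comp_apply, convIncl,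
      RingHom.coe_mk, MonoidHom.coe_mk, OneHom.coe_mk, mul'_apply, LinearEquiv.coe_coe]
    induction α.coact y with
    | zero => simp
    | add a b ha hb => simp only [map_add, TensorProduct.tmul_add, mul_add, ha, hb]
    | tmul a b => simp

/-- The coaction condition as an equation in the convolution algebra `Hom(C, H ⊗ H)`. -/
theorem coaction_iff (α : HopfCoaction R H C) (φ : WithConv (C →ₗ[R] H)) :
    (comul ∘ₗ φ.ofConv = (mul' R H).lTensor H ∘ₗ (TensorProduct.assoc R H H H).toLinearMap ∘ₗ
      TensorProduct.map (φ.ofConv.rTensor H ∘ₗ α.coact) φ.ofConv ∘ₗ comul) ↔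
    toConv (comul ∘ₗ φ.ofConv) = α.push φ * convIncl R H C H φ := by
  rw [WithConv.ext_iff, push_mul_convIncl]
  refine Eq.congr_right ?_
  ext c
  simp only [LinearMap.comp_apply]
  induction comul (R := R) c with
  | zero => simp
  | add x y hx hy => simp only [map_add, hx, hy]
  | tmul x y =>
    simp only [TensorProduct.map_tmul, LinearMap.comp_apply, LinearEquiv.coe_coe]
    induction α.coact x with
    | zero => simp
    | add a b ha hb => simp only [map_add, TensorProduct.add_tmul, ha, hb]
    | tmul a b => simp

/-- The comodule condition as a commutation relation in a convolution algebra. -/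
theorem comodule_iff (α : HopfCoaction R H C) (φ : WithConv (C →ₗ[R] H)) :
    ((mul' R H).lTensor C ∘ₗ (TensorProduct.assoc R C H H).toLinearMap ∘ₗ
      TensorProduct.map α.coact φ.ofConv ∘ₗ comul =
    (mul' R H).lTensor C ∘ₗ (TensorProduct.leftComm R H C H).toLinearMap ∘ₗ
      TensorProduct.map φ.ofConv α.coact ∘ₗ comul) ↔
    Commute (α.push (toConv (TensorAlgebra.ι R (M := C))))
      (convIncl R H C (TensorAlgebra R C) φ) := by
  rw [commute_iff_eq, WithConv.ext_iff, push_mul_convIncl, convIncl_mul_push]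
  refine ⟨fun h => by rw [h], fun h => ?_⟩
  have hinj : (TensorAlgebra.ιInv (R := R) (M := C)).rTensor H ∘ₗ
      (TensorAlgebra.ι R (M := C)).rTensor H = LinearMap.id := by
    rw [← LinearMap.rTensor_comp]
    convert LinearMap.rTensor_id H C
    ext c
    exact TensorAlgebra.ι_leftInverse c
  have h' := congrArg ((TensorAlgebra.ιInv (R := R) (M := C)).rTensor H ∘ₗ ·) h
  simpa only [← LinearMap.comp_assoc, hinj, LinearMap.id_comp] using h'

theorem commute_push (α : HopfCoaction R H C) {φ : WithConv (C →ₗ[R] H)}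
    (hφ : IsCocharacter α φ.ofConv) {A : Type u} [Ring A] [Algebra R A]
    (g : WithConv (C →ₗ[R] A)) : Commute (α.push g) (convIncl R H C A φ) := by
  rw [commute_iff_eq, WithConv.ext_iff, push_mul_convIncl, convIncl_mul_push, hφ.comodule]

theorem IsCocharacter.one (α : HopfCoaction R H C) :
    IsCocharacter α (1 : WithConv (C →ₗ[R] H)).ofConv where
  counit_comp := by ext c; simp [LinearMap.convOne_def]
  coaction := by
    rw [coaction_iff, α.push_one, map_one, mul_one]
    apply WithConv.ext; ext c
    simp [LinearMap.convOne_def]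
  comodule := by
    rw [comodule_iff, map_one]; exact Commute.one_right _

theorem comul_convMul (φ ψ : WithConv (C →ₗ[R] H)) :
    toConv (comul ∘ₗ (φ * ψ).ofConv) =
      toConv (comul (R := R) ∘ₗ φ.ofConv) * toConv (comul ∘ₗ ψ.ofConv) :=
  WithConv.ext (LinearMap.algHom_comp_convMul_distrib (Bialgebra.comulAlgHom R H) φ ψ)

theorem counit_convMul (φ ψ : WithConv (C →ₗ[R] H)) :
    toConv (counit ∘ₗ (φ * ψ).ofConv) =
      toConv (counit (R := R) ∘ₗ φ.ofConv) * toConv (counit ∘ₗ ψ.ofConv) :=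
  WithConv.ext (LinearMap.algHom_comp_convMul_distrib (Bialgebra.counitAlgHom R H) φ ψ)

theorem IsCocharacter.mul {α : HopfCoaction R H C} {φ ψ : WithConv (C →ₗ[R] H)}
    (hφ : IsCocharacter α φ.ofConv) (hψ : IsCocharacter α ψ.ofConv) :
    IsCocharacter α (φ * ψ).ofConv where
  counit_comp := by
    have h := counit_convMul φ ψ
    rw [hφ.counit_comp, hψ.counit_comp] at h
    have h1 : toConv (counit (R := R) (A := C)) = (1 : WithConv (C →ₗ[R] R)) := by
      apply WithConv.ext; ext c; simp [LinearMap.convOne_def]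
    rw [h1, one_mul, ← h1] at h
    exact congrArg WithConv.ofConv h
  coaction := by
    rw [coaction_iff, comul_convMul, (coaction_iff α φ).1 hφ.coaction,
      (coaction_iff α ψ).1 hψ.coaction, α.push_mul, map_mul, mul_assoc, mul_assoc,
      ← mul_assoc _ (α.push ψ), ← (commute_push α hφ ψ).eq, mul_assoc]
  comodule := by
    rw [comodule_iff, map_mul]
    exact ((comodule_iff α φ).1 hφ.comodule).mul_right ((comodule_iff α ψ).1 hψ.comodule)

theorem IsCocharacter.inv {α : HopfCoaction R H C} {φ : (WithConv (C →ₗ[R] H))ˣ}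
    (hφ : IsCocharacter α φ.val.ofConv) : IsCocharacter α (φ⁻¹).val.ofConv where
  counit_comp := by
    have h := counit_convMul φ.val (φ⁻¹).val
    rw [Units.mul_inv, hφ.counit_comp, (IsCocharacter.one α).counit_comp] at h
    have h1 : toConv (counit (R := R) (A := C)) = (1 : WithConv (C →ₗ[R] R)) := by
      apply WithConv.ext; ext c; simp [LinearMap.convOne_def]
    rw [h1, one_mul, ← h1] at h
    exact (congrArg WithConv.ofConv h).symm
  coaction := by
    rw [coaction_iff]
    have hc := (coaction_iff α _).1 hφ.coaction
    have h1 : toConv (comul ∘ₗ (φ⁻¹).val.ofConv) * toConv (comul (R := R) ∘ₗ φ.val.ofConv) = 1 := by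
      rw [← comul_convMul, Units.inv_mul]
      apply WithConv.ext; ext c
      simp [LinearMap.convOne_def]
    have h2 : toConv (comul (R := R) ∘ₗ φ.val.ofConv) *
        (α.push (φ⁻¹).val * convIncl R H C H (φ⁻¹).val) = 1 := by
      rw [hc, (commute_push α hφ φ.val).eq, mul_assoc, ← mul_assoc (α.push φ.val), ← α.push_mul,
        Units.mul_inv, α.push_one, one_mul, ← map_mul, Units.mul_inv, map_one]
    exact left_inv_eq_right_inv h1 h2
  comodule := by
    rw [comodule_iff]
    have h := (comodule_iff α _).1 hφ.comodule
    exact Commute.units_inv_right (u := Units.map (convIncl R H C (TensorAlgebra R C)).toMonoidHom φ) h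

/-- The group `Γ(C ↻ H)` of `H`-equivariant cocharacters: the convolution invertible linear maps
`C → H` satisfying the cocharacter equations, under convolution. -/
def cocharacterGroup (α : HopfCoaction R H C) : Subgroup (WithConv (C →ₗ[R] H))ˣ where
  carrier := {φ | IsCocharacter α φ.val.ofConv}
  mul_mem' hφ hψ := hφ.mul hψ
  one_mem' := IsCocharacter.one α
  inv_mem' hφ := hφ.inv

/-- `c ↦ f(c) 1`, as a homomorphism `Hom(C, R) → Hom(C, A)` of convolution algebras. -/
def convScalar (R C : Type u) [CommRing R] [AddCommGroup C] [Module R C] [Coalgebra R C]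
    (A : Type u) [Ring A] [Algebra R A] : WithConv (C →ₗ[R] R) →+* WithConv (C →ₗ[R] A) where
  toFun f := toConv (Algebra.linearMap R A ∘ₗ f.ofConv)
  map_one' := by apply WithConv.ext; ext c; simp [LinearMap.convOne_def]
  map_mul' f g := by
    apply WithConv.ext
    exact LinearMap.algHom_comp_convMul_distrib (Algebra.ofId R A) f g
  map_zero' := by apply WithConv.ext; ext c; simp
  map_add' φ ψ := by apply WithConv.ext; ext c; simp

/-- A functional `f : C → R` is cocentral if `f(c₍₁₎) c₍₂₎ = f(c₍₂₎) c₍₁₎`. -/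
def IsCocentral (f : C →ₗ[R] R) : Prop :=
  (TensorProduct.lid R C).toLinearMap ∘ₗ f.rTensor C ∘ₗ comul =
    (TensorProduct.rid R C).toLinearMap ∘ₗ f.lTensor C ∘ₗ comul

theorem convScalar_mul {A : Type u} [Ring A] [Algebra R A] (f : WithConv (C →ₗ[R] R))
    (g : WithConv (C →ₗ[R] A)) : (convScalar R C A f * g).ofConv =
      g.ofConv ∘ₗ (TensorProduct.lid R C).toLinearMap ∘ₗ f.ofConv.rTensor C ∘ₗ comul := by
  ext c
  rw [LinearMap.convMul_def]
  simp only [LinearMap.comp_apply]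
  induction comul (R := R) c with
  | zero => simp
  | add x y hx hy => simp only [map_add, hx, hy]
  | tmul x y => simp [convScalar, Algebra.smul_def]

theorem mul_convScalar {A : Type u} [Ring A] [Algebra R A] (f : WithConv (C →ₗ[R] R))
    (g : WithConv (C →ₗ[R] A)) : (g * convScalar R C A f).ofConv =
      g.ofConv ∘ₗ (TensorProduct.rid R C).toLinearMap ∘ₗ f.ofConv.lTensor C ∘ₗ comul := by
  ext c
  rw [LinearMap.convMul_def]
  simp only [LinearMap.comp_apply]
  induction comul (R := R) c with
  | zero => simp
  | add x y hx hy => simp only [map_add, hx, hy]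
  | tmul x y =>
    simp [convScalar, Algebra.smul_def, (Algebra.commutes (f.ofConv y) (g.ofConv x)).symm]

theorem IsCocentral.commute {f : WithConv (C →ₗ[R] R)} (hf : IsCocentral f.ofConv) {A : Type u}
    [Ring A] [Algebra R A] (g : WithConv (C →ₗ[R] A)) : Commute (convScalar R C A f) g := by
  rw [commute_iff_eq, WithConv.ext_iff, convScalar_mul, mul_convScalar, hf]

theorem isCocentral_iff (f : WithConv (C →ₗ[R] R)) : IsCocentral f.ofConv ↔
    Commute (convScalar R C (TensorAlgebra R C) f) (toConv (TensorAlgebra.ι R (M := C))) := by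
  refine ⟨fun hf => hf.commute _, fun h => ?_⟩
  rw [commute_iff_eq, WithConv.ext_iff, convScalar_mul, mul_convScalar] at h
  ext c
  exact TensorAlgebra.ι_leftInverse.injective (LinearMap.congr_fun h c)

theorem IsCocentral.one : IsCocentral (1 : WithConv (C →ₗ[R] R)).ofConv := by
  rw [isCocentral_iff, map_one]; exact Commute.one_left _

theorem IsCocentral.mul {f g : WithConv (C →ₗ[R] R)} (hf : IsCocentral f.ofConv)
    (hg : IsCocentral g.ofConv) : IsCocentral (f * g).ofConv := by
  rw [isCocentral_iff, map_mul]; exact (hf.commute _).mul_left (hg.commute _)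

theorem IsCocentral.inv {f : (WithConv (C →ₗ[R] R))ˣ} (hf : IsCocentral f.val.ofConv) :
    IsCocentral (f⁻¹).val.ofConv := by
  rw [isCocentral_iff] at hf ⊢
  exact Commute.units_inv_left
    (u := Units.map (convScalar R C (TensorAlgebra R C)).toMonoidHom f) hf

/-- `c ↦ f(c⁽⁰⁾) c⁽¹⁾` -/
def pushScalar (α : HopfCoaction R H C) (f : WithConv (C →ₗ[R] R)) : WithConv (C →ₗ[R] H) :=
  toConv ((TensorProduct.lid R H).toLinearMap ∘ₗ f.ofConv.rTensor H ∘ₗ α.coact)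

theorem pushScalar_mul (α : HopfCoaction R H C) (f g : WithConv (C →ₗ[R] R)) :
    pushScalar α (f * g) = pushScalar α f * pushScalar α g := by
  have h := LinearMap.algHom_comp_convMul_distrib
    (Algebra.TensorProduct.lid R H : R ⊗[R] H →ₐ[R] H) (α.push f) (α.push g)
  rw [← α.push_mul] at h
  exact WithConv.ext h

theorem pushScalar_one (α : HopfCoaction R H C) : pushScalar α 1 = 1 := by
  have h := congrArg WithConv.ofConv (α.push_one (A := R))
  apply WithConv.ext
  ext c
  have h1 := congrArg (TensorProduct.lid R H) (LinearMap.congr_fun h c)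
  refine Eq.trans h1 ?_
  simp [LinearMap.convOne_def, Algebra.TensorProduct.one_def, Algebra.algebraMap_eq_smul_one]

theorem commute_pushScalar {α : HopfCoaction R H C} {φ : WithConv (C →ₗ[R] H)}
    (hφ : IsCocharacter α φ.ofConv) (f : WithConv (C →ₗ[R] R)) :
    Commute (pushScalar α f) φ := by
  have h1 := LinearMap.algHom_comp_convMul_distrib
    (Algebra.TensorProduct.lid R H : R ⊗[R] H →ₐ[R] H) (α.push f) (convIncl R H C R φ)
  have h2 := LinearMap.algHom_comp_convMul_distrib
    (Algebra.TensorProduct.lid R H : R ⊗[R] H →ₐ[R] H) (convIncl R H C R φ) (α.push f)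
  rw [(commute_push α hφ f).eq, h2] at h1
  have h3 : toConv ((Algebra.TensorProduct.lid R H : R ⊗[R] H →ₐ[R] H).toLinearMap ∘ₗ
      (convIncl R H C R φ).ofConv) = φ := by
    apply WithConv.ext; ext c; simp [convIncl]
  rw [h3] at h1
  exact (WithConv.ext h1).symm

/-- The inner cocharacter `c ↦ f(c₍₁₎⁽⁰⁾) c₍₁₎⁽¹⁾ f⁻¹(c₍₂₎)` of a convolution invertible
functional `f`, i.e. the convolution product of `c ↦ f(c⁽⁰⁾) c⁽¹⁾` with the convolution inverse
of `c ↦ f(c) 1`. -/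
def innerCocharacter (α : HopfCoaction R H C) (f : (WithConv (C →ₗ[R] R))ˣ) :
    WithConv (C →ₗ[R] H) :=
  pushScalar α f.val * convScalar R C H (f⁻¹).val

theorem innerCocharacter_mul (α : HopfCoaction R H C) {f g : (WithConv (C →ₗ[R] R))ˣ}
    (hf : IsCocentral f.val.ofConv) (hg : IsCocentral g.val.ofConv) :
    innerCocharacter α (f * g) = innerCocharacter α f * innerCocharacter α g := by
  simp only [innerCocharacter, mul_inv_rev, Units.val_mul, map_mul, pushScalar_mul]
  rw [(hg.inv.commute (convScalar R C H (f⁻¹).val)).eq, mul_assoc, mul_assoc,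
    ← mul_assoc (convScalar R C H (f⁻¹).val) (pushScalar α g.val),
    (hf.inv.commute (pushScalar α g.val)).eq, mul_assoc]

theorem innerCocharacter_one (α : HopfCoaction R H C) : innerCocharacter α 1 = 1 := by
  simp [innerCocharacter, pushScalar_one]

/-- The subgroup of inner cocharacters: those of the form
`c ↦ f(c₍₁₎⁽⁰⁾) c₍₁₎⁽¹⁾ f⁻¹(c₍₂₎)`, where `f` is a cocentral convolution invertible functional,
i.e. an invertible element of the dual algebra of the cocenter of `C`. -/
def innerCocharacters (α : HopfCoaction R H C) : Subgroup (cocharacterGroup α) where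
  carrier := {φ | ∃ f : (WithConv (C →ₗ[R] R))ˣ,
    IsCocentral f.val.ofConv ∧ φ.val.val = innerCocharacter α f}
  one_mem' := ⟨1, IsCocentral.one, (innerCocharacter_one α).symm⟩
  mul_mem' := by
    rintro φ ψ ⟨f, hf, hφ⟩ ⟨g, hg, hψ⟩
    refine ⟨f * g, hf.mul hg, ?_⟩
    rw [innerCocharacter_mul α hf hg, ← hφ, ← hψ]
    rfl
  inv_mem' := by
    rintro φ ⟨f, hf, hφ⟩
    refine ⟨f⁻¹, hf.inv, ?_⟩
    have h : φ.val.val * innerCocharacter α f⁻¹ = 1 := by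
      rw [hφ, ← innerCocharacter_mul α hf hf.inv, mul_inv_cancel, innerCocharacter_one]
    exact left_inv_eq_right_inv (Units.inv_mul φ.val) h

instance innerCocharacters_normal (α : HopfCoaction R H C) : (innerCocharacters α).Normal where
  conj_mem := by
    rintro φ ⟨f, hf, hφ⟩ ψ
    refine ⟨f, hf, ?_⟩
    have h : Commute (innerCocharacter α f) ψ.val.val :=
      (commute_pushScalar ψ.2 f.val).mul_left (hf.inv.commute ψ.val.val)
    have h1 : (ψ * φ * ψ⁻¹).val.val = ψ.val.val * φ.val.val * (ψ.val⁻¹).val := rfl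
    rw [h1, hφ, ← h.eq, mul_assoc, Units.mul_inv, mul_one]

/-- The first homoschism group `S¹(H, C)`: cocharacters modulo inner cocharacters. -/
abbrev FirstHomoschism (α : HopfCoaction R H C) : Type u :=
  cocharacterGroup α ⧸ innerCocharacters α

end Coactions

/-! ### Equivariant comodules and bicomodules -/

section Equivariant

variable {R : Type u} [CommRing R] {H : Type u} [Ring H] [HopfAlgebra R H]
  {C : Type u} [AddCommGroup C] [Module R C] [Coalgebra R C]
  {D : Type u} [AddCommGroup D] [Module R D] [Coalgebra R D]

/-- An `H`-equivariant right `C`-comodule: a right `C`-comodule `M` with an `H`-comodule structure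
such that `(m⁽⁰⁾)₍₀₎ ⊗ (m⁽⁰⁾)₍₁₎ ⊗ m⁽¹⁾ = m₍₀₎⁽⁰⁾ ⊗ m₍₁₎⁽⁰⁾ ⊗ m₍₀₎⁽¹⁾ m₍₁₎⁽¹⁾`. -/
structure EquivariantRightComodule (α : HopfCoaction R H C) (M : Type u) [AddCommGroup M]
    [Module R M] extends RightComodule R C M where
  hopf : RightComodule R H M
  equivariant : coact.rTensor H ∘ₗ hopf.coact = diag hopf.coact α.coact ∘ₗ coact

/-- An `H`-equivariant left `C`-comodule. -/
structure EquivariantLeftComodule (α : HopfCoaction R H C) (M : Type u) [AddCommGroup M]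
    [Module R M] extends LeftComodule R C M where
  hopf : RightComodule R H M
  equivariant : coact.rTensor H ∘ₗ hopf.coact = diag α.coact hopf.coact ∘ₗ coact

/-- Morphisms of `H`-equivariant right comodules: maps colinear over `C` and over `H`. -/
def EquivariantRightComodule.IsHom {α : HopfCoaction R H C} {M : Type u} [AddCommGroup M]
    [Module R M] {N : Type u} [AddCommGroup N] [Module R N] (ρ : EquivariantRightComodule α M)
    (σ : EquivariantRightComodule α N) (f : M →ₗ[R] N) : Prop :=
  ρ.toRightComodule.IsHom σ.toRightComodule f ∧ ρ.hopf.IsHom σ.hopf f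

/-- Morphisms of `H`-equivariant left comodules: maps colinear over `C` and over `H`. -/
def EquivariantLeftComodule.IsHom {α : HopfCoaction R H C} {M : Type u} [AddCommGroup M]
    [Module R M] {N : Type u} [AddCommGroup N] [Module R N] (ρ : EquivariantLeftComodule α M)
    (σ : EquivariantLeftComodule α N) (f : M →ₗ[R] N) : Prop :=
  ρ.toLeftComodule.IsHom σ.toLeftComodule f ∧ ρ.hopf.IsHom σ.hopf f

/-- `C` as an `H`-equivariant left comodule over itself. -/
def EquivariantLeftComodule.regular (α : HopfCoaction R H C) : EquivariantLeftComodule α C where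
  coact := Coalgebra.comul
  coassoc := Coalgebra.coassoc
  counit := by
    ext c
    simp
  hopf := α.toRightComodule
  equivariant := α.coflat.symm

/-- A `(D, C)`-bicomodule: a left `D`-comodule and right `C`-comodule with commuting structure
maps. -/
structure Bicomodule (R : Type u) [CommRing R] (D : Type u) [AddCommGroup D] [Module R D]
    [Coalgebra R D] (C : Type u) [AddCommGroup C] [Module R C] [Coalgebra R C]
    (M : Type u) [AddCommGroup M] [Module R M] where
  left : LeftComodule R D M
  right : RightComodule R C M
  comm : (TensorProduct.assoc R D M C).toLinearMap ∘ₗ left.coact.rTensor C ∘ₗ right.coact =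
    right.coact.lTensor D ∘ₗ left.coact

variable {M : Type u} [AddCommGroup M] [Module R M]

/-- An `H`-coaction on the `(D, C)`-bicomodule `M` making it an `H`-equivariant bicomodule, where
`H` coacts on `D` by `β` and on `C` by `α`. -/
@[ext]
structure EquivariantCoaction (β : HopfCoaction R H D) (α : HopfCoaction R H C)
    (B : Bicomodule R D C M) extends RightComodule R H M where
  left_equivariant : B.left.coact.rTensor H ∘ₗ coact = diag β.coact coact ∘ₗ B.left.coact
  right_equivariant : B.right.coact.rTensor H ∘ₗ coact = diag coact α.coact ∘ₗ B.right.coact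

namespace EquivariantCoaction

variable {β : HopfCoaction R H D} {α : HopfCoaction R H C} {B : Bicomodule R D C M}

/-- The underlying `H`-equivariant left `D`-comodule. -/
def asLeft (δ : EquivariantCoaction β α B) : EquivariantLeftComodule β M where
  toLeftComodule := B.left
  hopf := δ.toRightComodule
  equivariant := δ.left_equivariant

/-- The twirled coaction `δ_φ(m) = m₍₀₎⁽⁰⁾ ⊗ m₍₀₎⁽¹⁾ φ(m₍₁₎)`. -/
def twirl (δ : EquivariantCoaction β α B) (φ : C →ₗ[R] H) : M →ₗ[R] M ⊗[R] H :=
  (LinearMap.mul' R H).lTensor M ∘ₗ (TensorProduct.assoc R M H H).toLinearMap ∘ₗ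
    TensorProduct.map δ.coact φ ∘ₗ B.right.coact

/-- Two coactions `δ`, `δ'` on `M` are isomorphic if there is an automorphism `u` of the bicomodule
`M` with `δ'(m) = u(u⁻¹(m)⁽⁰⁾) ⊗ u⁻¹(m)⁽¹⁾`, that is, an isomorphism `(M, δ) → (M, δ')` of
`H`-equivariant bicomodules. -/
def isoSetoid (β : HopfCoaction R H D) (α : HopfCoaction R H C) (B : Bicomodule R D C M) :
    Setoid (EquivariantCoaction β α B) where
  r δ δ' := ∃ u : M ≃ₗ[R] M, B.left.IsHom B.left u.toLinearMap ∧
    B.right.IsHom B.right u.toLinearMap ∧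
    δ'.coact = u.toLinearMap.rTensor H ∘ₗ δ.coact ∘ₗ u.symm.toLinearMap
  iseqv := by
    refine ⟨fun δ => ⟨LinearEquiv.refl R M, ?_, ?_, ?_⟩, ?_, ?_⟩
    · simp [LeftComodule.IsHom]
    · simp [RightComodule.IsHom]
    · simp
    · rintro δ δ' ⟨u, hl, hr, h⟩
      have hu : u.toLinearMap ∘ₗ u.symm.toLinearMap = LinearMap.id := by ext; simp
      have hu' : u.symm.toLinearMap ∘ₗ u.toLinearMap = LinearMap.id := by ext; simp
      refine ⟨u.symm, ?_, ?_, ?_⟩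
      · have := congrArg (fun f => u.symm.toLinearMap.lTensor D ∘ₗ f ∘ₗ u.symm.toLinearMap) hl
        simp only [LinearMap.comp_assoc, hu, LinearMap.comp_id] at this
        rw [← LinearMap.comp_assoc, ← LinearMap.lTensor_comp, hu',
          LinearMap.lTensor_id, LinearMap.id_comp] at this
        exact this.symm
      · have := congrArg (fun f => u.symm.toLinearMap.rTensor C ∘ₗ f ∘ₗ u.symm.toLinearMap) hr
        simp only [LinearMap.comp_assoc, hu, LinearMap.comp_id] at this
        rw [← LinearMap.comp_assoc, ← LinearMap.rTensor_comp, hu',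
          LinearMap.rTensor_id, LinearMap.id_comp] at this
        exact this.symm
      · rw [h, ← LinearMap.comp_assoc, ← LinearMap.comp_assoc, ← LinearMap.rTensor_comp, hu',
          LinearMap.rTensor_id, LinearMap.id_comp, LinearEquiv.symm_symm, LinearMap.comp_assoc,
          hu', LinearMap.comp_id]
    · rintro δ δ' δ'' ⟨u, hl, hr, h⟩ ⟨v, hl', hr', h'⟩
      refine ⟨u.trans v, ?_, ?_, ?_⟩
      · simp only [LeftComodule.IsHom, LinearEquiv.coe_trans] at hl hl' ⊢
        rw [← LinearMap.comp_assoc, hl', LinearMap.comp_assoc, hl, ← LinearMap.comp_assoc,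
          ← LinearMap.lTensor_comp]
      · simp only [RightComodule.IsHom, LinearEquiv.coe_trans] at hr hr' ⊢
        rw [← LinearMap.comp_assoc, hr', LinearMap.comp_assoc, hr, ← LinearMap.comp_assoc,
          ← LinearMap.rTensor_comp]
      · rw [h', h, LinearEquiv.coe_trans, LinearMap.rTensor_comp]
        ext m
        simp

/-- Isomorphism classes of `H`-coactions making the bicomodule `M` an `H`-equivariant
bicomodule. -/
abbrev IsoClasses (β : HopfCoaction R H D) (α : HopfCoaction R H C)
    (B : Bicomodule R D C M) : Type u :=
  Quotient (isoSetoid β α B)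

/-! ### Equivariant Morita-Takeuchi bicomodules -/

/-- `f : Y → M ⊗ Z` is a morphism `Y → M □ Z` of `H`-equivariant left `D`-comodules into the
cotensor product over `C`: it takes values in the equalizer `M □ Z` of `ρ_M ⊗ id` and `id ⊗ ρ_Z`,
and is colinear over `D` and over `H`, where `D` coacts on the factor `M` of `M ⊗ Z` and `H` coacts
diagonally. -/
structure IsCotensorHom (δ : EquivariantCoaction β α B) {Y : Type u} [AddCommGroup Y] [Module R Y]
    (y : EquivariantLeftComodule β Y) {Z : Type u} [AddCommGroup Z] [Module R Z]
    (z : EquivariantLeftComodule α Z) (f : Y →ₗ[R] M ⊗[R] Z) : Prop where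
  cotensor : (TensorProduct.assoc R M C Z).toLinearMap ∘ₗ B.right.coact.rTensor Z ∘ₗ f =
    z.coact.lTensor M ∘ₗ f
  colinear : (TensorProduct.assoc R D M Z).toLinearMap ∘ₗ B.left.coact.rTensor Z ∘ₗ f =
    f.lTensor D ∘ₗ y.coact
  hopf_colinear : diag δ.coact z.hopf.coact ∘ₗ f = f.rTensor H ∘ₗ y.hopf.coact

/-- `(X, η)` is a universal arrow from `Y` to the functor `M □ -` from `H`-equivariant left
`C`-comodules to `H`-equivariant left `D`-comodules. That is, `X = CoHom_H(M, Y)` is the value at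
`Y` of a left adjoint of `M □ -`, with unit `η : Y → M □ X`. -/
def IsCoHom (δ : EquivariantCoaction β α B) {Y : Type u} [AddCommGroup Y] [Module R Y]
    (y : EquivariantLeftComodule β Y) {X : Type u} [AddCommGroup X] [Module R X]
    (x : EquivariantLeftComodule α X) (η : Y →ₗ[R] M ⊗[R] X) : Prop :=
  δ.IsCotensorHom y x η ∧
    ∀ (Z : Type u) [AddCommGroup Z] [Module R Z] (z : EquivariantLeftComodule α Z)
      (f : Y →ₗ[R] M ⊗[R] Z), δ.IsCotensorHom y z f →
      ∃! g : X →ₗ[R] Z, x.IsHom z g ∧ g.lTensor M ∘ₗ η = f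

/-- `M` is quasi-finite: the functor `M □ -` from `H`-equivariant left `C`-comodules to
`H`-equivariant left `D`-comodules has a left adjoint `CoHom_H(M, -)`. -/
def IsQuasiFinite (δ : EquivariantCoaction β α B) : Prop :=
  ∀ (Y : Type u) [AddCommGroup Y] [Module R Y] (y : EquivariantLeftComodule β Y),
    ∃ (X : Type u) (_ : AddCommGroup X) (_ : Module R X) (x : EquivariantLeftComodule α X)
      (η : Y →ₗ[R] M ⊗[R] X), δ.IsCoHom y x η

/-- `M` is an injector: the functor `CoHom_H(M, -)` is exact, i.e. it maps a short exact sequence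
`0 → Y₁ → Y₂ → Y₃ → 0` (of maps `a`, `b`) to a short exact sequence (of the induced maps `a'`,
`b'`). -/
def IsInjector (δ : EquivariantCoaction β α B) : Prop :=
  ∀ (Y₁ Y₂ Y₃ X₁ X₂ X₃ : Type u) [AddCommGroup Y₁] [Module R Y₁] [AddCommGroup Y₂] [Module R Y₂]
    [AddCommGroup Y₃] [Module R Y₃] [AddCommGroup X₁] [Module R X₁] [AddCommGroup X₂] [Module R X₂]
    [AddCommGroup X₃] [Module R X₃]
    (y₁ : EquivariantLeftComodule β Y₁) (y₂ : EquivariantLeftComodule β Y₂)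
    (y₃ : EquivariantLeftComodule β Y₃) (x₁ : EquivariantLeftComodule α X₁)
    (x₂ : EquivariantLeftComodule α X₂) (x₃ : EquivariantLeftComodule α X₃)
    (η₁ : Y₁ →ₗ[R] M ⊗[R] X₁) (η₂ : Y₂ →ₗ[R] M ⊗[R] X₂) (η₃ : Y₃ →ₗ[R] M ⊗[R] X₃)
    (a : Y₁ →ₗ[R] Y₂) (b : Y₂ →ₗ[R] Y₃) (a' : X₁ →ₗ[R] X₂) (b' : X₂ →ₗ[R] X₃),
    δ.IsCoHom y₁ x₁ η₁ → δ.IsCoHom y₂ x₂ η₂ → δ.IsCoHom y₃ x₃ η₃ →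
    y₁.IsHom y₂ a → y₂.IsHom y₃ b → x₁.IsHom x₂ a' → x₂.IsHom x₃ b' →
    a'.lTensor M ∘ₗ η₁ = η₂ ∘ₗ a → b'.lTensor M ∘ₗ η₂ = η₃ ∘ₗ b →
    Function.Injective a → Function.Exact a b → Function.Surjective b →
    Function.Injective a' ∧ Function.Exact a' b' ∧ Function.Surjective b'

/-- The cotensor product `N □ M` over `D`. -/
def cotensor (B : Bicomodule R D C M) {N : Type u} [AddCommGroup N] [Module R N]
    (n : RightComodule R D N) : Submodule R (N ⊗[R] M) :=
  LinearMap.eqLocus ((TensorProduct.assoc R N D M).toLinearMap ∘ₗ n.coact.rTensor M)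
    (B.left.coact.lTensor N)

/-- `M` is faithfully coflat as a left `D`-comodule: the functor `- □ M` from `H`-equivariant right
`D`-comodules to `R`-modules is exact (the first part) and faithful (the second part). -/
def IsFaithfullyCoflat (_ : EquivariantCoaction β α B) : Prop :=
  (∀ (N₁ N₂ N₃ : Type u) [AddCommGroup N₁] [Module R N₁] [AddCommGroup N₂] [Module R N₂]
    [AddCommGroup N₃] [Module R N₃] (n₁ : EquivariantRightComodule β N₁)
    (n₂ : EquivariantRightComodule β N₂) (n₃ : EquivariantRightComodule β N₃)
    (a : N₁ →ₗ[R] N₂) (b : N₂ →ₗ[R] N₃), n₁.IsHom n₂ a → n₂.IsHom n₃ b →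
    Function.Injective a → Function.Exact a b → Function.Surjective b →
    Set.InjOn (a.rTensor M) (cotensor B n₁.toRightComodule) ∧
    (∀ t ∈ cotensor B n₂.toRightComodule,
      b.rTensor M t = 0 ↔ ∃ s ∈ cotensor B n₁.toRightComodule, a.rTensor M s = t) ∧
    Set.SurjOn (b.rTensor M) (cotensor B n₂.toRightComodule) (cotensor B n₃.toRightComodule)) ∧
  (∀ (N₁ N₂ : Type u) [AddCommGroup N₁] [Module R N₁] [AddCommGroup N₂] [Module R N₂]
    (n₁ : EquivariantRightComodule β N₁) (n₂ : EquivariantRightComodule β N₂)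
    (a b : N₁ →ₗ[R] N₂), n₁.IsHom n₂ a → n₁.IsHom n₂ b →
    Set.EqOn (a.rTensor M) (b.rTensor M) (cotensor B n₁.toRightComodule) → a = b)

/-- The coendomorphism coalgebra `CoEnd_H(M) = CoHom_H(M, M)` is naturally isomorphic to `C`: the
canonical map `CoHom_H(M, M) → C`, which corresponds under the adjunction to the structure map
`M ≅ M □ C → M ⊗ C`, is an isomorphism. (The coalgebra structure of `CoEnd_H(M)` is the unique one
for which the unit `M → M ⊗ CoEnd_H(M)` is a comodule structure, so the canonical map always
respects the coalgebra structures.) -/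
def CoEndIsCanonical (δ : EquivariantCoaction β α B) : Prop :=
  ∀ (X : Type u) [AddCommGroup X] [Module R X] (x : EquivariantLeftComodule α X)
    (η : M →ₗ[R] M ⊗[R] X) (g : X →ₗ[R] C), δ.IsCoHom δ.asLeft x η →
    x.IsHom (EquivariantLeftComodule.regular α) g → g.lTensor M ∘ₗ η = B.right.coact →
    Function.Bijective g

/-- `(M, δ)` is an `H`-equivariant Morita-Takeuchi bicomodule. -/
structure IsMoritaTakeuchi (δ : EquivariantCoaction β α B) : Prop where
  quasiFinite : δ.IsQuasiFinite
  faithfullyCoflat : δ.IsFaithfullyCoflat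
  injector : δ.IsInjector
  coEnd : δ.CoEndIsCanonical

end EquivariantCoaction

end Equivariant

end

end HopfEquivariant

/-!
Fix the `(D, C)`-bicomodule `M`. For an algebra `A`, the linear maps `M → M ⊗ A` form a monoid
under Kleisli composition, `KleisliEnd R A M`, and `g ↦ f_g`, `f_g(m) = m₍₀₎ ⊗ g(m₍₁₎)`, is a
homomorphism to it from the convolution algebra `Hom(C, A)` (`RightComodule.convHom`). An
`H`-coaction `δ` is an element of `KleisliEnd R H M`, invertible because of the antipode
(`RightComodule.unit`), and the twisted coaction is the product `δ_φ = δ f_φ`. In this language the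
axioms of an equivariant coaction are multiplicative identities:

* coassociativity reads `δ_L δ_R = δ_Δ` over `H ⊗ H`, the index denoting the image under one of
  the two inclusions or under the comultiplication (`RightComodule.unitMap_mul_unitMap`);
* equivariance over `C` reads `(f_g)_L δ_R = δ_R f_{g'}` over `A ⊗ H`, where
  `g'(c) = g(c⁽⁰⁾) ⊗ c⁽¹⁾` (`RightComodule.map_convHom_mul`).

What makes the action free and transitive is a universal property of `C`: every `D`-colinear map
`M → M ⊗ A` is `f_g` for a unique linear map `g : C → A` (`EquivariantCoaction.exists_convHom_eq`,
`EquivariantCoaction.convHom_injective`). Quasi-finiteness and `CoEnd_H(M) ≅ C` say that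
`M → M ⊗ C` is universal among morphisms of *equivariant* comodules. To remove the equivariance, one
tests this against the cofree equivariant comodules `C ⊗ (A ⊗ H)`: the `D`-colinear maps
`f : M → M ⊗ A` correspond to the `D`- and `H`-colinear maps `δ_R⁻¹ f_L δ_R : M → M ⊗ (A ⊗ H)`
(`EquivariantCoaction.cofreeLift`), just as the linear maps `C → A` correspond to the `H`-colinear
maps `C → A ⊗ H`.

Given equivariant coactions `δ` and `δ'`, the quotient `δ⁻¹ δ'` is `D`-colinear
(`EquivariantCoaction.isColinear_inv_mul_mul`), so it is `f_φ` for a unique `φ`, and `δ' = δ_φ`.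
After cancelling the invertible element `δ` and the injective map `g ↦ f_g`, the coaction axioms of
`δ_φ` become exactly the equations of a cocharacter for `φ`
(`EquivariantCoaction.isCocharacter_of_twist_eq`), and `φ` is invertible with inverse coming from
`δ'⁻¹ δ`.

The same universal property with `A = R` shows that the automorphisms `u` of the bicomodule `M` are
the maps `m ↦ m₍₀₎ f(m₍₁₎)` for `f` convolution invertible and cocentral, and then
`(u ⊗ id) δ u⁻¹` is the twist of `δ` by the inner cocharacter of `f` (`EquivariantCoaction.iso_iff`).
Hence the isomorphism classes are the orbits of the normal subgroup of inner cocharacters, and the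
statement on `S¹(H, C)` is the formal passage to the quotient (`exists_mulAction_quotient`).
-/

namespace HopfEquivariant

noncomputable section

open LinearMap WithConv Coalgebra

/-! ### The Kleisli monoid of a module -/

/-- The linear maps `N → N ⊗ A`, that is, the endomorphisms of `N` in the Kleisli category of the
monad `- ⊗ A`. -/
@[ext]
structure KleisliEnd (R : Type u) [CommRing R] (A : Type u) [Ring A] [Algebra R A]
    (N : Type u) [AddCommGroup N] [Module R N] where
  /-- The underlying linear map. -/
  toLin : N →ₗ[R] N ⊗[R] A

namespace KleisliEnd

variable {R : Type u} [CommRing R] {A : Type u} [Ring A] [Algebra R A]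
  {A' : Type u} [Ring A'] [Algebra R A'] {N : Type u} [AddCommGroup N] [Module R N]

/-- The right `A`-linear extension `n ⊗ a ↦ k(n) a` of `k : N → N ⊗ A` to `N ⊗ A`. -/
def extend (k : KleisliEnd R A N) : N ⊗[R] A →ₗ[R] N ⊗[R] A :=
  (mul' R A).lTensor N ∘ₗ (TensorProduct.assoc R N A A).toLinearMap ∘ₗ k.toLin.rTensor A

theorem extend_tmul (k : KleisliEnd R A N) (n : N) (a : A) :
    k.extend (n ⊗ₜ[R] a) = (mulRight R a).lTensor N (k.toLin n) := by
  simp only [extend, LinearMap.comp_apply, rTensor_tmul, LinearEquiv.coe_coe]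
  induction k.toLin n with
  | zero => simp
  | add x y hx hy => simp only [map_add, TensorProduct.add_tmul, hx, hy]
  | tmul x y => simp

theorem extend_lTensor_mulRight (k : KleisliEnd R A N) (a : A) (t : N ⊗[R] A) :
    k.extend ((mulRight R a).lTensor N t) = (mulRight R a).lTensor N (k.extend t) := by
  induction t with
  | zero => simp
  | add x y hx hy => simp only [map_add, hx, hy]
  | tmul n b =>
    rw [lTensor_tmul, extend_tmul, extend_tmul, ← lTensor_comp_apply]
    congr 2
    ext; simp [mul_assoc]

/-- Kleisli composition. -/
instance : Mul (KleisliEnd R A N) := ⟨fun k l => ⟨k.extend ∘ₗ l.toLin⟩⟩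

instance : One (KleisliEnd R A N) := ⟨⟨(TensorProduct.mk R N A).flip 1⟩⟩

theorem toLin_mul (k l : KleisliEnd R A N) : (k * l).toLin = k.extend ∘ₗ l.toLin := rfl

@[simp]
theorem toLin_one (n : N) : (1 : KleisliEnd R A N).toLin n = n ⊗ₜ 1 := rfl

theorem extend_mul (k l : KleisliEnd R A N) : (k * l).extend = k.extend ∘ₗ l.extend := by
  ext n a
  simp only [AlgebraTensorModule.curry_apply, curry_apply, restrictScalars_self,
    LinearMap.comp_apply, extend_tmul, toLin_mul, extend_lTensor_mulRight]

@[simp]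
theorem extend_one : (1 : KleisliEnd R A N).extend = LinearMap.id := by
  ext n a
  simp [extend_tmul]

instance : Monoid (KleisliEnd R A N) where
  mul_assoc k l m := by
    ext1
    rw [toLin_mul, toLin_mul, toLin_mul, extend_mul, LinearMap.comp_assoc]
  one_mul k := by ext1; simp [toLin_mul]
  mul_one k := by ext1; ext n; simp [toLin_mul, extend_tmul]

theorem extend_comp_extend {k l : KleisliEnd R A N} (h : k * l = 1) :
    k.extend ∘ₗ l.extend = LinearMap.id := by
  rw [← extend_mul, h, extend_one]

theorem lTensor_comp_extend (j : A →ₐ[R] A') (k : KleisliEnd R A N) :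
    j.toLinearMap.lTensor N ∘ₗ k.extend =
      extend ⟨j.toLinearMap.lTensor N ∘ₗ k.toLin⟩ ∘ₗ j.toLinearMap.lTensor N := by
  ext n a
  simp only [AlgebraTensorModule.curry_apply, curry_apply, restrictScalars_self,
    LinearMap.comp_apply, extend_tmul, lTensor_tmul, ← lTensor_comp_apply]
  congr 2
  ext; simp

/-- Change of algebra along `j : A → A'`. -/
def map (j : A →ₐ[R] A') : KleisliEnd R A N →* KleisliEnd R A' N where
  toFun k := ⟨j.toLinearMap.lTensor N ∘ₗ k.toLin⟩
  map_one' := by ext1; ext n; simp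
  map_mul' k l := by
    ext1
    rw [toLin_mul, toLin_mul, ← LinearMap.comp_assoc, lTensor_comp_extend, LinearMap.comp_assoc]

theorem toLin_map (j : A →ₐ[R] A') (k : KleisliEnd R A N) :
    (map j k).toLin = j.toLinearMap.lTensor N ∘ₗ k.toLin := rfl

theorem map_map {A'' : Type u} [Ring A''] [Algebra R A''] (j' : A' →ₐ[R] A'') (j : A →ₐ[R] A')
    (k : KleisliEnd R A N) : map j' (map j k) = map (j'.comp j) k := by
  ext1
  rw [toLin_map, toLin_map, toLin_map, ← LinearMap.comp_assoc, ← lTensor_comp]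
  rfl

@[simp]
theorem map_id (k : KleisliEnd R A N) : map (AlgHom.id R A) k = k := by
  ext1
  rw [toLin_map, AlgHom.toLinearMap_id, lTensor_id, LinearMap.id_comp]

/-- The composite `N → N ⊗ H → N ⊗ A ⊗ H` of linear maps `l` and `k ⊗ id` is a Kleisli product
over the algebra `A ⊗ H`. -/
theorem assoc_comp_rTensor {H : Type u} [Ring H] [Algebra R H] (k : KleisliEnd R A N) :
    (TensorProduct.assoc R N A H).toLinearMap ∘ₗ k.toLin.rTensor H =
      (map (Algebra.TensorProduct.includeLeft : A →ₐ[R] A ⊗[R] H) k).extend ∘ₗ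
        (Algebra.TensorProduct.includeRight : H →ₐ[R] A ⊗[R] H).toLinearMap.lTensor N := by
  ext n h
  simp only [AlgebraTensorModule.curry_apply, curry_apply, restrictScalars_self,
    LinearMap.comp_apply, extend_tmul, lTensor_tmul, toLin_map, rTensor_tmul, LinearEquiv.coe_coe]
  induction k.toLin n with
  | zero => simp
  | add x y hx hy => simp only [map_add, TensorProduct.add_tmul, hx, hy]
  | tmul x y => simp

end KleisliEnd

section Comodules

variable {R : Type u} [CommRing R] {C : Type u} [AddCommGroup C] [Module R C] [Coalgebra R C]
  {A : Type u} [Ring A] [Algebra R A] {A' : Type u} [Ring A'] [Algebra R A']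
  {N : Type u} [AddCommGroup N] [Module R N]

/-- The homomorphism from the convolution algebra `Hom(C, A)` to the Kleisli monoid of the
right `C`-comodule `N` that maps `g` to `n ↦ n₍₀₎ ⊗ g(n₍₁₎)`. -/
def RightComodule.convHom (ρ : RightComodule R C N) :
    WithConv (C →ₗ[R] A) →* KleisliEnd R A N where
  toFun g := ⟨g.ofConv.lTensor N ∘ₗ ρ.coact⟩
  map_one' := by
    ext1
    have h := congrArg (fun f => (TensorProduct.mk R N A).flip 1 ∘ₗ f) ρ.counit
    refine Eq.trans ?_ h
    dsimp only
    rw [← LinearMap.comp_assoc, ← LinearMap.comp_assoc]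
    congr 1
    ext n c
    simp [LinearMap.convOne_def, Algebra.algebraMap_eq_smul_one, TensorProduct.smul_tmul']
  map_mul' g h := by
    ext1
    have h1 : KleisliEnd.extend ⟨g.ofConv.lTensor N ∘ₗ ρ.coact⟩ ∘ₗ h.ofConv.lTensor N =
        (mul' R A ∘ₗ TensorProduct.map g.ofConv h.ofConv).lTensor N ∘ₗ
          (TensorProduct.assoc R N C C).toLinearMap ∘ₗ ρ.coact.rTensor C := by
      ext n c
      simp only [AlgebraTensorModule.curry_apply, curry_apply, restrictScalars_self,
        LinearMap.comp_apply, KleisliEnd.extend_tmul, lTensor_tmul, rTensor_tmul,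
        LinearEquiv.coe_coe]
      induction ρ.coact n with
      | zero => simp
      | add x y hx hy => simp only [map_add, TensorProduct.add_tmul, hx, hy]
      | tmul x y => simp
    rw [KleisliEnd.toLin_mul, ← LinearMap.comp_assoc, h1, LinearMap.comp_assoc,
      LinearMap.comp_assoc, ρ.coassoc, ← LinearMap.comp_assoc, ← lTensor_comp]
    rfl

theorem RightComodule.toLin_convHom (ρ : RightComodule R C N) (g : WithConv (C →ₗ[R] A)) :
    (ρ.convHom g).toLin = g.ofConv.lTensor N ∘ₗ ρ.coact := rfl

theorem RightComodule.map_convHom (ρ : RightComodule R C N) (j : A →ₐ[R] A')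
    (g : WithConv (C →ₗ[R] A)) :
    KleisliEnd.map j (ρ.convHom g) = ρ.convHom (toConv (j.toLinearMap ∘ₗ g.ofConv)) := by
  ext1
  rw [KleisliEnd.toLin_map, RightComodule.toLin_convHom, RightComodule.toLin_convHom,
    ← LinearMap.comp_assoc, ← lTensor_comp]

end Comodules

section HopfComodules

variable {R : Type u} [CommRing R] {H : Type u} [Ring H] [HopfAlgebra R H]
  {A : Type u} [Ring A] [Algebra R A] {N : Type u} [AddCommGroup N] [Module R N]

/-- The coaction of an `H`-comodule as an invertible element of its Kleisli monoid over `H`; the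
inverse is `n ↦ n⁽⁰⁾ ⊗ S(n⁽¹⁾)`. -/
def RightComodule.unit (δ : RightComodule R H N) : (KleisliEnd R H N)ˣ where
  val := ⟨δ.coact⟩
  inv := δ.convHom (toConv (HopfAlgebra.antipode R))
  val_inv := by
    have h : δ.convHom (toConv LinearMap.id) = ⟨δ.coact⟩ := by
      ext1; simp [RightComodule.toLin_convHom]
    rw [← h, ← map_mul, LinearMap.id_mul_antipode, map_one]
  inv_val := by
    have h : δ.convHom (toConv LinearMap.id) = ⟨δ.coact⟩ := by
      ext1; simp [RightComodule.toLin_convHom]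
    rw [← h, ← map_mul, LinearMap.antipode_mul_id, map_one]

/-- The invertible element `n ↦ n⁽⁰⁾ ⊗ j(n⁽¹⁾)` of the Kleisli monoid over `A`, for an algebra
homomorphism `j : H → A`. -/
def RightComodule.unitMap (δ : RightComodule R H N) (j : H →ₐ[R] A) : (KleisliEnd R A N)ˣ :=
  Units.map (KleisliEnd.map j) δ.unit

theorem RightComodule.toLin_unit (δ : RightComodule R H N) : δ.unit.val.toLin = δ.coact := rfl

theorem RightComodule.toLin_unitMap (δ : RightComodule R H N) (j : H →ₐ[R] A) :
    (δ.unitMap j).val.toLin = j.toLinearMap.lTensor N ∘ₗ δ.coact := rfl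

theorem RightComodule.map_unitMap {A' : Type u} [Ring A'] [Algebra R A']
    (δ : RightComodule R H N) (j : H →ₐ[R] A) (j' : A →ₐ[R] A') :
    Units.map (KleisliEnd.map j') (δ.unitMap j) = δ.unitMap (j'.comp j) :=
  Units.ext (KleisliEnd.map_map j' j _)

theorem RightComodule.unitMap_id (δ : RightComodule R H N) : δ.unitMap (AlgHom.id R H) = δ.unit :=
  Units.ext (KleisliEnd.map_id _)

theorem RightComodule.unitMap_counit (δ : RightComodule R H N) :
    δ.unitMap (Bialgebra.counitAlgHom R H) = 1 := by
  ext1; ext1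
  rw [RightComodule.toLin_unitMap, ← δ.toLin_unit]
  ext n
  have h := LinearMap.congr_fun δ.counit n
  exact (TensorProduct.rid R N).injective (h.trans (by simp))

/-- Coassociativity of an `H`-coaction, in the Kleisli monoid over `H ⊗ H`. -/
theorem RightComodule.unitMap_mul_unitMap (δ : RightComodule R H N) :
    δ.unitMap (Algebra.TensorProduct.includeLeft : H →ₐ[R] H ⊗[R] H) *
      δ.unitMap (Algebra.TensorProduct.includeRight : H →ₐ[R] H ⊗[R] H) =
    δ.unitMap (Bialgebra.comulAlgHom R H) := by
  ext1; ext1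
  have h := δ.coassoc
  rw [← LinearMap.comp_assoc, ← δ.toLin_unit, KleisliEnd.assoc_comp_rTensor] at h
  exact h

end HopfComodules

/-! ### Colinearity in the Kleisli monoid -/

namespace KleisliEnd

variable {R : Type u} [CommRing R] {A : Type u} [Ring A] [Algebra R A]
  {D : Type u} [AddCommGroup D] [Module R D] {M : Type u} [AddCommGroup M] [Module R M]

/-- The operator `d ⊗ m ⊗ a ↦ d' ⊗ m ⊗ x a` on `D ⊗ (M ⊗ A)`, where `κ(d) = d' ⊗ x`. -/
def slide (M : Type u) [AddCommGroup M] [Module R M] (κ : KleisliEnd R A D) :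
    D ⊗[R] (M ⊗[R] A) →ₗ[R] D ⊗[R] (M ⊗[R] A) :=
  (TensorProduct.leftComm R M D A).toLinearMap ∘ₗ κ.extend.lTensor M ∘ₗ
    (TensorProduct.leftComm R D M A).toLinearMap

theorem slide_tmul (κ : KleisliEnd R A D) (d : D) (m : M) (a : A) :
    κ.slide M (d ⊗ₜ (m ⊗ₜ a)) = TensorProduct.leftComm R M D A (m ⊗ₜ κ.extend (d ⊗ₜ a)) := by
  simp [slide]

@[simp]
theorem slide_one : (1 : KleisliEnd R A D).slide M = LinearMap.id := by
  ext d m a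
  simp [slide]

theorem slide_mul (κ κ' : KleisliEnd R A D) :
    (κ * κ').slide M = κ.slide M ∘ₗ κ'.slide M := by
  refine LinearMap.ext fun t => ?_
  simp only [slide, extend_mul, lTensor_comp, LinearMap.comp_apply, LinearEquiv.coe_coe]
  congr 2
  exact ((TensorProduct.leftComm R M D A).symm_apply_apply _).symm

theorem slide_injective {κ κ' : KleisliEnd R A D} (h : κ' * κ = 1) :
    Function.Injective (κ.slide M) := by
  refine Function.LeftInverse.injective (g := κ'.slide M) fun t => ?_
  rw [← LinearMap.comp_apply, ← slide_mul, h, slide_one, LinearMap.id_apply]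

theorem slide_mulRight (κ : KleisliEnd R A D) (a : A) (t : D ⊗[R] (M ⊗[R] A)) :
    κ.slide M (((mulRight R a).lTensor M).lTensor D t) =
      ((mulRight R a).lTensor M).lTensor D (κ.slide M t) := by
  have key : ∀ (m : M) (s : D ⊗[R] A),
      TensorProduct.leftComm R M D A (m ⊗ₜ (mulRight R a).lTensor D s) =
        ((mulRight R a).lTensor M).lTensor D (TensorProduct.leftComm R M D A (m ⊗ₜ s)) := by
    intro m s
    induction s with
    | zero => simp
    | add x y hx hy => simp only [map_add, TensorProduct.tmul_add, hx, hy]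
    | tmul x y => simp
  induction t with
  | zero => simp
  | add x y hx hy => simp only [map_add, hx, hy]
  | tmul d t =>
    induction t with
    | zero => simp
    | add x y hx hy => simp only [map_add, TensorProduct.tmul_add, hx, hy]
    | tmul m b =>
      rw [lTensor_tmul, lTensor_tmul, slide_tmul, slide_tmul, ← key, ← extend_lTensor_mulRight,
        lTensor_tmul]

/-- Operators with coefficients in the two factors of `A ⊗ H` commute. -/
theorem slide_includeRight_comp {H : Type u} [Ring H] [Algebra R H] (κ : KleisliEnd R H D)
    (f : KleisliEnd R A M) :
    (map (Algebra.TensorProduct.includeRight : H →ₐ[R] A ⊗[R] H) κ).slide M ∘ₗ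
        (map (Algebra.TensorProduct.includeLeft : A →ₐ[R] A ⊗[R] H) f).extend.lTensor D =
      (map (Algebra.TensorProduct.includeLeft : A →ₐ[R] A ⊗[R] H) f).extend.lTensor D ∘ₗ
        (map (Algebra.TensorProduct.includeRight : H →ₐ[R] A ⊗[R] H) κ).slide M := by
  apply TensorProduct.ext_threefold'
  intro d m x
  obtain ⟨S, hS⟩ := TensorProduct.exists_finset (f.toLin m)
  obtain ⟨T, hT⟩ := TensorProduct.exists_finset (κ.toLin d)
  simp only [LinearMap.comp_apply, lTensor_tmul, slide_tmul, extend_tmul, toLin_map, hS, hT,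
    map_sum, TensorProduct.tmul_sum, TensorProduct.leftComm_tmul, AlgHom.toLinearMap_apply,
    Algebra.TensorProduct.includeLeft_apply, Algebra.TensorProduct.includeRight_apply,
    mulRight_apply]
  rw [Finset.sum_comm]
  simp only [← mul_assoc, Algebra.TensorProduct.tmul_mul_tmul, one_mul, mul_one]

theorem assoc_comp_diag (κ : KleisliEnd R A D) (k : KleisliEnd R A M) :
    (TensorProduct.assoc R D M A).toLinearMap ∘ₗ diag κ.toLin k.toLin =
      κ.slide M ∘ₗ k.toLin.lTensor D := by
  ext d m
  obtain ⟨S, hS⟩ := TensorProduct.exists_finset (k.toLin m)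
  obtain ⟨T, hT⟩ := TensorProduct.exists_finset (κ.toLin d)
  simp only [AlgebraTensorModule.curry_apply, curry_apply, restrictScalars_self,
    LinearMap.comp_apply, LinearEquiv.coe_coe, diag, TensorProduct.map_tmul, hS, hT,
    TensorProduct.tmul_sum, TensorProduct.sum_tmul, map_sum, lTensor_tmul,
    TensorProduct.tensorTensorTensorComm_tmul, TensorProduct.assoc_tmul, mul'_apply,
    slide_tmul, extend_tmul, TensorProduct.leftComm_tmul, mulRight_apply]

end KleisliEnd

section Colinear

variable {R : Type u} [CommRing R] {D : Type u} [AddCommGroup D] [Module R D] [Coalgebra R D]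
  {A : Type u} [Ring A] [Algebra R A] {M : Type u} [AddCommGroup M] [Module R M]

/-- The map `M ⊗ A → D ⊗ (M ⊗ A)` induced by a left comodule structure on `M`. -/
def LeftComodule.tensorCoact (l : LeftComodule R D M) (A : Type u) [AddCommGroup A]
    [Module R A] : M ⊗[R] A →ₗ[R] D ⊗[R] (M ⊗[R] A) :=
  (TensorProduct.assoc R D M A).toLinearMap ∘ₗ l.coact.rTensor A

/-- `k : M → M ⊗ A` is colinear over the left comodule `M` up to the operator `κ : D → D ⊗ A`:
`k(m)₍₋₁₎ ⊗ k(m)₍₀₎ = κ(m₍₋₁₎) k(m₍₀₎)`. For `κ = 1`, this is colinearity over `D`; for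
the coactions `κ`, `k` of a Hopf algebra on `D` and `M`, it is equivariance. -/
def LeftComodule.IsColinear (l : LeftComodule R D M) (κ : KleisliEnd R A D)
    (k : KleisliEnd R A M) : Prop :=
  l.tensorCoact A ∘ₗ k.toLin = κ.slide M ∘ₗ k.toLin.lTensor D ∘ₗ l.coact

theorem LeftComodule.tensorCoact_mulRight (l : LeftComodule R D M) (a : A) (t : M ⊗[R] A) :
    l.tensorCoact A ((mulRight R a).lTensor M t) =
      ((mulRight R a).lTensor M).lTensor D (l.tensorCoact A t) := by
  induction t with
  | zero => simp
  | add x y hx hy => simp only [map_add, hx, hy]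
  | tmul m b =>
    simp only [tensorCoact, LinearMap.comp_apply, rTensor_tmul, lTensor_tmul,
      LinearEquiv.coe_coe]
    induction l.coact m with
    | zero => simp
    | add x y hx hy => simp only [map_add, TensorProduct.add_tmul, hx, hy]
    | tmul x y => simp

theorem LeftComodule.IsColinear.extend {l : LeftComodule R D M} {κ : KleisliEnd R A D}
    {k : KleisliEnd R A M} (h : l.IsColinear κ k) :
    l.tensorCoact A ∘ₗ k.extend = κ.slide M ∘ₗ k.extend.lTensor D ∘ₗ l.tensorCoact A := by
  ext m a
  simp only [AlgebraTensorModule.curry_apply, curry_apply, restrictScalars_self,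
    LinearMap.comp_apply, KleisliEnd.extend_tmul, l.tensorCoact_mulRight]
  have h1 := LinearMap.congr_fun h m
  simp only [LinearMap.comp_apply] at h1
  rw [h1, ← KleisliEnd.slide_mulRight]
  congr 1
  simp only [tensorCoact, LinearMap.comp_apply, rTensor_tmul, LinearEquiv.coe_coe]
  induction l.coact m with
  | zero => simp
  | add x y hx hy => simp only [map_add, TensorProduct.add_tmul, hx, hy]
  | tmul x y => simp [KleisliEnd.extend_tmul]

theorem LeftComodule.IsColinear.one (l : LeftComodule R D M) :
    l.IsColinear (1 : KleisliEnd R A D) 1 := by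
  ext m
  simp only [tensorCoact, LinearMap.comp_apply, LinearEquiv.coe_coe, KleisliEnd.toLin_one,
    rTensor_tmul, KleisliEnd.slide_one, LinearMap.id_apply]
  induction l.coact m with
  | zero => simp
  | add x y hx hy => simp only [map_add, TensorProduct.add_tmul, hx, hy]
  | tmul x y => simp

theorem LeftComodule.IsColinear.mul {l : LeftComodule R D M} {κ κ' : KleisliEnd R A D}
    {k k' : KleisliEnd R A M} (h : l.IsColinear κ k) (h' : l.IsColinear κ' k')
    (hc : κ'.slide M ∘ₗ k.extend.lTensor D = k.extend.lTensor D ∘ₗ κ'.slide M) :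
    l.IsColinear (κ * κ') (k * k') := by
  rw [IsColinear, KleisliEnd.toLin_mul, ← LinearMap.comp_assoc, h.extend, LinearMap.comp_assoc,
    LinearMap.comp_assoc, h', KleisliEnd.slide_mul, lTensor_comp]
  simp only [← LinearMap.comp_assoc]
  rw [LinearMap.comp_assoc (κ'.slide M), LinearMap.comp_assoc _ (κ'.slide M), hc]

/-- Cancellation of an invertible factor in a colinear product. -/
theorem LeftComodule.IsColinear.of_mul {l : LeftComodule R D M} (κ : (KleisliEnd R A D)ˣ)
    (k : (KleisliEnd R A M)ˣ) {k' : KleisliEnd R A M} (h : l.IsColinear κ.val k.val)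
    (h' : l.IsColinear κ.val (k.val * k')) : l.IsColinear 1 k' := by
  rw [IsColinear, KleisliEnd.toLin_mul, ← LinearMap.comp_assoc, h.extend, LinearMap.comp_assoc,
    LinearMap.comp_assoc, lTensor_comp] at h'
  have hk : k.inv.extend.lTensor D ∘ₗ k.val.extend.lTensor D = LinearMap.id := by
    rw [← lTensor_comp, KleisliEnd.extend_comp_extend k.inv_val, lTensor_id]
  ext m
  have h1 := KleisliEnd.slide_injective κ.inv_val (LinearMap.congr_fun h' m)
  have h2 := congrArg (k.inv.extend.lTensor D) h1
  simp only [LinearMap.comp_apply] at h2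
  rw [← LinearMap.comp_apply (k.inv.extend.lTensor D), ← LinearMap.comp_apply
    (k.inv.extend.lTensor D), hk] at h2
  rw [KleisliEnd.slide_one]
  exact h2

variable {C : Type u} [AddCommGroup C] [Module R C] [Coalgebra R C]

theorem Bicomodule.isColinear_convHom (B : Bicomodule R D C M) (g : WithConv (C →ₗ[R] A)) :
    B.left.IsColinear 1 (B.right.convHom g) := by
  have h : B.left.tensorCoact A ∘ₗ g.ofConv.lTensor M =
      (g.ofConv.lTensor M).lTensor D ∘ₗ B.left.tensorCoact C := by
    ext m c
    simp only [AlgebraTensorModule.curry_apply, curry_apply, restrictScalars_self,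
      LeftComodule.tensorCoact, LinearMap.comp_apply, rTensor_tmul, lTensor_tmul,
      LinearEquiv.coe_coe]
    induction B.left.coact m with
    | zero => simp
    | add x y hx hy => simp only [map_add, TensorProduct.add_tmul, hx, hy]
    | tmul x y => simp
  rw [LeftComodule.IsColinear, RightComodule.toLin_convHom, ← LinearMap.comp_assoc, h,
    KleisliEnd.slide_one, LinearMap.id_comp, LinearMap.comp_assoc, LeftComodule.tensorCoact,
    LinearMap.comp_assoc, B.comm, lTensor_comp, LinearMap.comp_assoc]

end Colinear

/-! ### Equivariance in the Kleisli monoid -/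

section Equivariance

variable {R : Type u} [CommRing R] {H : Type u} [Ring H] [HopfAlgebra R H]
  {C : Type u} [AddCommGroup C] [Module R C] [Coalgebra R C]
  {D : Type u} [AddCommGroup D] [Module R D] [Coalgebra R D]
  {A : Type u} [Ring A] [Algebra R A] {M : Type u} [AddCommGroup M] [Module R M]

theorem LeftComodule.isColinear_iff (l : LeftComodule R D M) (κ : KleisliEnd R H D)
    (k : KleisliEnd R H M) : l.IsColinear κ k ↔
      l.coact.rTensor H ∘ₗ k.toLin = diag κ.toLin k.toLin ∘ₗ l.coact := by
  rw [IsColinear, ← LinearMap.comp_assoc l.coact, ← KleisliEnd.assoc_comp_diag, tensorCoact,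
    LinearMap.comp_assoc, LinearMap.comp_assoc]
  refine ⟨fun h => ?_, fun h => by rw [h]⟩
  ext m
  exact (TensorProduct.assoc R D M H).injective (LinearMap.congr_fun h m)

theorem LeftComodule.IsColinear.map {A' : Type u} [Ring A'] [Algebra R A']
    {l : LeftComodule R D M} {κ : KleisliEnd R A D} {k : KleisliEnd R A M}
    (h : l.IsColinear κ k) (j : A →ₐ[R] A') : l.IsColinear (κ.map j) (k.map j) := by
  have h1 : l.tensorCoact A' ∘ₗ j.toLinearMap.lTensor M =
      (j.toLinearMap.lTensor M).lTensor D ∘ₗ l.tensorCoact A := by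
    ext m c
    simp only [AlgebraTensorModule.curry_apply, curry_apply, restrictScalars_self,
      LeftComodule.tensorCoact, LinearMap.comp_apply, rTensor_tmul, lTensor_tmul,
      LinearEquiv.coe_coe]
    induction l.coact m with
    | zero => simp
    | add x y hx hy => simp only [map_add, TensorProduct.add_tmul, hx, hy]
    | tmul x y => simp
  have h2 : (j.toLinearMap.lTensor M).lTensor D ∘ₗ κ.slide M =
      (κ.map j).slide M ∘ₗ (j.toLinearMap.lTensor M).lTensor D := by
    apply TensorProduct.ext_threefold'
    intro d m a
    obtain ⟨T, hT⟩ := TensorProduct.exists_finset (κ.toLin d)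
    simp [KleisliEnd.slide_tmul, KleisliEnd.extend_tmul, KleisliEnd.toLin_map, hT,
      TensorProduct.tmul_sum]
  rw [IsColinear, KleisliEnd.toLin_map, ← LinearMap.comp_assoc, h1, LinearMap.comp_assoc, h,
    ← LinearMap.comp_assoc, h2, lTensor_comp]
  simp only [LinearMap.comp_assoc]

/-- The operator by which a right coaction on `C` enters the Kleisli monoid of a right
`C`-comodule. -/
theorem assoc_comp_rTensor_comp_diag (α : HopfCoaction R H C) (k : KleisliEnd R H M)
    (g : WithConv (C →ₗ[R] A)) :
    (TensorProduct.assoc R M A H).toLinearMap ∘ₗ (g.ofConv.lTensor M).rTensor H ∘ₗ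
        diag k.toLin α.coact =
      (k.map (Algebra.TensorProduct.includeRight : H →ₐ[R] A ⊗[R] H)).extend ∘ₗ
        (α.push g).ofConv.lTensor M := by
  ext m c
  obtain ⟨S, hS⟩ := TensorProduct.exists_finset (k.toLin m)
  obtain ⟨T, hT⟩ := TensorProduct.exists_finset (α.coact c)
  simp only [AlgebraTensorModule.curry_apply, curry_apply, restrictScalars_self,
    LinearMap.comp_apply, LinearEquiv.coe_coe, diag, TensorProduct.map_tmul, hS, hT,
    TensorProduct.tmul_sum, TensorProduct.sum_tmul, map_sum, lTensor_tmul, rTensor_tmul,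
    TensorProduct.tensorTensorTensorComm_tmul, TensorProduct.assoc_tmul, mul'_apply,
    KleisliEnd.extend_tmul, KleisliEnd.toLin_map, mulRight_apply, HopfCoaction.push,
    AlgHom.toLinearMap_apply, Algebra.TensorProduct.includeRight_apply,
    Algebra.TensorProduct.tmul_mul_tmul, one_mul]

/-- Equivariance over a right comodule is a commutation rule in the Kleisli monoid. -/
theorem RightComodule.map_convHom_mul (ρ : RightComodule R C M) (α : HopfCoaction R H C)
    (k : KleisliEnd R H M) (hk : ρ.coact.rTensor H ∘ₗ k.toLin = diag k.toLin α.coact ∘ₗ ρ.coact)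
    (g : WithConv (C →ₗ[R] A)) :
    (ρ.convHom g).map (Algebra.TensorProduct.includeLeft : A →ₐ[R] A ⊗[R] H) *
        k.map (Algebra.TensorProduct.includeRight : H →ₐ[R] A ⊗[R] H) =
      k.map (Algebra.TensorProduct.includeRight : H →ₐ[R] A ⊗[R] H) * ρ.convHom (α.push g) := by
  ext1
  rw [KleisliEnd.toLin_mul, KleisliEnd.toLin_mul, RightComodule.toLin_convHom,
    KleisliEnd.toLin_map, ← LinearMap.comp_assoc, ← LinearMap.comp_assoc,
    ← KleisliEnd.assoc_comp_rTensor, ← assoc_comp_rTensor_comp_diag,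
    RightComodule.toLin_convHom, rTensor_comp]
  simp only [LinearMap.comp_assoc]
  rw [hk]

/-- Converse of `RightComodule.map_convHom_mul`; it is enough to know the commutation rule for one
injective map `C → A` with a retraction, such as the inclusion in the tensor algebra. -/
theorem RightComodule.equivariant_of_map_convHom_mul (ρ : RightComodule R C M)
    (α : HopfCoaction R H C) (k : KleisliEnd R H M)
    (h : (ρ.convHom (toConv (TensorAlgebra.ι R (M := C)))).map Algebra.TensorProduct.includeLeft *
        k.map (Algebra.TensorProduct.includeRight : H →ₐ[R] TensorAlgebra R C ⊗[R] H) =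
      k.map Algebra.TensorProduct.includeRight *
        ρ.convHom (α.push (toConv (TensorAlgebra.ι R (M := C))))) :
    ρ.coact.rTensor H ∘ₗ k.toLin = diag k.toLin α.coact ∘ₗ ρ.coact := by
  have hι : TensorAlgebra.ιInv (R := R) (M := C) ∘ₗ TensorAlgebra.ι R (M := C) =
      LinearMap.id := LinearMap.ext TensorAlgebra.ι_leftInverse
  have hinj : ((TensorAlgebra.ιInv (R := R) (M := C)).lTensor M).rTensor H ∘ₗ
      ((TensorAlgebra.ι R (M := C)).lTensor M).rTensor H = LinearMap.id := by
    rw [← rTensor_comp, ← lTensor_comp, hι, lTensor_id, rTensor_id]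
  have h1 := congrArg KleisliEnd.toLin h
  rw [KleisliEnd.toLin_mul, KleisliEnd.toLin_mul, RightComodule.toLin_convHom,
    KleisliEnd.toLin_map, ← LinearMap.comp_assoc, ← LinearMap.comp_assoc,
    ← KleisliEnd.assoc_comp_rTensor, ← assoc_comp_rTensor_comp_diag,
    RightComodule.toLin_convHom, rTensor_comp] at h1
  simp only [LinearMap.comp_assoc] at h1
  ext m
  have h2 := (TensorProduct.assoc R M _ H).injective (LinearMap.congr_fun h1 m)
  have h3 := congrArg (((TensorAlgebra.ιInv (R := R) (M := C)).lTensor M).rTensor H) h2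
  simp only [LinearMap.comp_apply] at h3
  rw [← LinearMap.comp_apply (((TensorAlgebra.ιInv (R := R) (M := C)).lTensor M).rTensor H),
    ← LinearMap.comp_apply (((TensorAlgebra.ιInv (R := R) (M := C)).lTensor M).rTensor H),
    hinj] at h3
  exact h3

variable {β : HopfCoaction R H D} {α : HopfCoaction R H C} {B : Bicomodule R D C M}

theorem EquivariantCoaction.isColinear_unitMap (δ : EquivariantCoaction β α B)
    (j : H →ₐ[R] A) :
    B.left.IsColinear (β.toRightComodule.unitMap j).val (δ.toRightComodule.unitMap j).val :=
  ((B.left.isColinear_iff β.toRightComodule.unit.val δ.toRightComodule.unit.val).2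
    δ.left_equivariant).map j

end Equivariance

/-! ### Cofree equivariant comodules -/

section Cofree

variable {R : Type u} [CommRing R] {H : Type u} [Ring H] [HopfAlgebra R H]
  {C : Type u} [AddCommGroup C] [Module R C] [Coalgebra R C]
  {D : Type u} [AddCommGroup D] [Module R D] [Coalgebra R D]
  {M : Type u} [AddCommGroup M] [Module R M] {N : Type u} [AddCommGroup N] [Module R N]
  {W : Type u} [AddCommGroup W] [Module R W]

/-- The tensor product of two `H`-comodules, with the diagonal coaction. -/
def RightComodule.tensor (ν : RightComodule R H N) (ω : RightComodule R H W) :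
    RightComodule R H (N ⊗[R] W) where
  coact := diag ν.coact ω.coact
  coassoc := by
    -- `P` multiplies the components in the algebra `H ⊗ H`
    obtain ⟨P, hP⟩ : ∃ P : (N ⊗[R] (H ⊗[R] H)) ⊗[R] (W ⊗[R] (H ⊗[R] H)) →ₗ[R]
        (N ⊗[R] W) ⊗[R] (H ⊗[R] H), P =
      (mul' R (H ⊗[R] H)).lTensor (N ⊗[R] W) ∘ₗ
        (TensorProduct.tensorTensorTensorComm R N (H ⊗[R] H) W (H ⊗[R] H)).toLinearMap := ⟨_, rfl⟩
    obtain ⟨Q, hQ⟩ : ∃ Q, Q = (mul' R H).lTensor (N ⊗[R] W) ∘ₗ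
      (TensorProduct.tensorTensorTensorComm R N H W H).toLinearMap := ⟨_, rfl⟩
    have h1 : (TensorProduct.assoc R (N ⊗[R] W) H H).toLinearMap ∘ₗ
        (diag ν.coact ω.coact).rTensor H ∘ₗ Q =
        P ∘ₗ TensorProduct.map ((TensorProduct.assoc R N H H).toLinearMap ∘ₗ ν.coact.rTensor H)
          ((TensorProduct.assoc R W H H).toLinearMap ∘ₗ ω.coact.rTensor H) := by
      apply TensorProduct.ext_fourfold'
      intro n h w k
      obtain ⟨S, hS⟩ := TensorProduct.exists_finset (ν.coact n)
      obtain ⟨T, hT⟩ := TensorProduct.exists_finset (ω.coact w)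
      simp only [hP, hQ, diag, LinearMap.comp_apply, LinearEquiv.coe_coe, lTensor_tmul,
        TensorProduct.tensorTensorTensorComm_tmul, mul'_apply, rTensor_tmul,
        TensorProduct.map_tmul, hS, hT, TensorProduct.sum_tmul, TensorProduct.tmul_sum, map_sum,
        TensorProduct.assoc_tmul, Algebra.TensorProduct.tmul_mul_tmul]
    have h2 : (comul (R := R) (A := H)).lTensor (N ⊗[R] W) ∘ₗ Q =
        P ∘ₗ TensorProduct.map ((comul (R := R) (A := H)).lTensor N)
          ((comul (R := R) (A := H)).lTensor W) := by
      apply TensorProduct.ext_fourfold'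
      intro n h w k
      simp only [hP, hQ, LinearMap.comp_apply, LinearEquiv.coe_coe, lTensor_tmul,
        TensorProduct.tensorTensorTensorComm_tmul, mul'_apply, TensorProduct.map_tmul,
        Bialgebra.comul_mul]
    have h3 := congrArg (· ∘ₗ TensorProduct.map ν.coact ω.coact) h1
    have h4 := congrArg (· ∘ₗ TensorProduct.map ν.coact ω.coact) h2
    simp only [LinearMap.comp_assoc, ← TensorProduct.map_comp, ν.coassoc, ω.coassoc] at h3 h4
    have h5 : diag ν.coact ω.coact = Q ∘ₗ TensorProduct.map ν.coact ω.coact := by rw [hQ]; rfl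
    rw [← h4, ← h5] at h3
    exact h3
  counit := by
    have h : (TensorProduct.rid R (N ⊗[R] W)).toLinearMap ∘ₗ
        (Coalgebra.counit (R := R) (A := H)).lTensor (N ⊗[R] W) ∘ₗ (mul' R H).lTensor (N ⊗[R] W) ∘ₗ
          (TensorProduct.tensorTensorTensorComm R N H W H).toLinearMap =
        TensorProduct.map ((TensorProduct.rid R N).toLinearMap ∘ₗ
          (Coalgebra.counit (R := R) (A := H)).lTensor N) ((TensorProduct.rid R W).toLinearMap ∘ₗ
          (Coalgebra.counit (R := R) (A := H)).lTensor W) := by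
      apply TensorProduct.ext_fourfold'
      intro n h w k
      simp only [LinearMap.comp_apply, LinearEquiv.coe_coe, lTensor_tmul,
        TensorProduct.tensorTensorTensorComm_tmul, mul'_apply, TensorProduct.rid_tmul,
        TensorProduct.map_tmul, Bialgebra.counit_mul, TensorProduct.smul_tmul_smul]
    have h1 := congrArg (· ∘ₗ TensorProduct.map ν.coact ω.coact) h
    simp only [LinearMap.comp_assoc, ← TensorProduct.map_comp, ν.counit, ω.counit,
      TensorProduct.map_id] at h1
    exact h1

/-- The cofree `H`-comodule `W ⊗ H`. -/
def RightComodule.cofree (H : Type u) [Ring H] [HopfAlgebra R H] (W : Type u) [AddCommGroup W]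
    [Module R W] : RightComodule R H (W ⊗[R] H) where
  coact := (TensorProduct.assoc R W H H).symm.toLinearMap ∘ₗ
    (comul (R := R) (A := H)).lTensor W
  coassoc := by
    ext w h
    have key : ∀ t : H ⊗[R] H, TensorProduct.assoc R (W ⊗[R] H) H H
        (((TensorProduct.assoc R W H H).symm.toLinearMap ∘ₗ
          (comul (R := R) (A := H)).lTensor W).rTensor H
            ((TensorProduct.assoc R W H H).symm (w ⊗ₜ t))) =
        (TensorProduct.assoc R W H (H ⊗[R] H)).symm
          (w ⊗ₜ TensorProduct.assoc R H H H (comul.rTensor H t)) := by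
      intro t
      induction t with
      | zero => simp
      | add x y hx hy => simp only [map_add, TensorProduct.tmul_add, hx, hy]
      | tmul x y =>
        simp only [TensorProduct.assoc_symm_tmul, rTensor_tmul, LinearMap.comp_apply,
          lTensor_tmul, LinearEquiv.coe_coe]
        induction comul (R := R) x with
        | zero => simp
        | add x y hx hy =>
          simp only [map_add, TensorProduct.tmul_add, TensorProduct.add_tmul, hx, hy]
        | tmul x y => simp
    have key' : ∀ t : H ⊗[R] H, (comul (R := R) (A := H)).lTensor (W ⊗[R] H)
        ((TensorProduct.assoc R W H H).symm (w ⊗ₜ t)) =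
        (TensorProduct.assoc R W H (H ⊗[R] H)).symm (w ⊗ₜ comul.lTensor H t) := by
      intro t
      induction t with
      | zero => simp
      | add x y hx hy => simp only [map_add, TensorProduct.tmul_add, hx, hy]
      | tmul x y => simp
    have h1 := key (comul h)
    rw [Coalgebra.coassoc_apply, ← key'] at h1
    exact h1
  counit := by
    ext w h
    have key : ∀ t : H ⊗[R] H, TensorProduct.rid R (W ⊗[R] H)
        ((Coalgebra.counit (R := R) (A := H)).lTensor (W ⊗[R] H)
          ((TensorProduct.assoc R W H H).symm (w ⊗ₜ t))) =
        w ⊗ₜ TensorProduct.rid R H (Coalgebra.counit.lTensor H t) := by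
      intro t
      induction t with
      | zero => simp
      | add x y hx hy => simp only [map_add, TensorProduct.tmul_add, hx, hy]
      | tmul x y => simp
    refine (key (comul h)).trans ?_
    simp

theorem RightComodule.coact_cofree_tmul (w : W) (h : H) :
    (RightComodule.cofree H W (R := R)).coact (w ⊗ₜ h) =
      (TensorProduct.assoc R W H H).symm (w ⊗ₜ comul h) := rfl

/-- The map `M ⊗ W → M ⊗ (C ⊗ W)` induced by a right comodule structure on `M`. -/
def RightComodule.coactTensor (ρ : RightComodule R C M) (W : Type u) [AddCommGroup W]
    [Module R W] : M ⊗[R] W →ₗ[R] M ⊗[R] (C ⊗[R] W) :=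
  (TensorProduct.assoc R M C W).toLinearMap ∘ₗ ρ.coact.rTensor W

/-- `C` as a right comodule over itself. -/
def RightComodule.regular (R C : Type u) [CommRing R] [AddCommGroup C] [Module R C]
    [Coalgebra R C] : RightComodule R C C where
  coact := comul
  coassoc := Coalgebra.coassoc
  counit := by ext c; simp

theorem RightComodule.coactTensor_coassoc (ρ : RightComodule R C M) :
    ρ.coactTensor (C ⊗[R] W) ∘ₗ ρ.coactTensor W =
      ((RightComodule.regular R C).coactTensor W).lTensor M ∘ₗ ρ.coactTensor W := by
  ext m w
  have h := congrArg (((TensorProduct.mk R C W).flip w).lTensor C |>.lTensor M)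
    (LinearMap.congr_fun ρ.coassoc m)
  simp only [AlgebraTensorModule.curry_apply, curry_apply, restrictScalars_self, coactTensor,
    LinearMap.comp_apply, rTensor_tmul, LinearEquiv.coe_coe] at h ⊢
  refine Eq.trans ?_ (h.trans ?_)
  · induction ρ.coact m with
    | zero => simp
    | add x y hx hy => simp only [map_add, TensorProduct.add_tmul, hx, hy]
    | tmul x y =>
      simp only [rTensor_tmul, TensorProduct.assoc_tmul]
      induction ρ.coact x with
      | zero => simp
      | add x y hx hy => simp only [map_add, TensorProduct.add_tmul, hx, hy]
      | tmul x y => simp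
  · induction ρ.coact m with
    | zero => simp
    | add x y hx hy => simp only [map_add, TensorProduct.add_tmul, hx, hy]
    | tmul x y =>
      simp only [lTensor_tmul, TensorProduct.assoc_tmul, LinearMap.comp_apply, rTensor_tmul,
        LinearEquiv.coe_coe, regular]
      congr 1
      induction comul (R := R) y with
      | zero => simp
      | add x y hx hy => simp only [map_add, TensorProduct.add_tmul, hx, hy]
      | tmul x y => simp

theorem RightComodule.coactTensor_counit (ρ : RightComodule R C M) :
    ((TensorProduct.lid R W).toLinearMap ∘ₗ
        (Coalgebra.counit (R := R) (A := C)).rTensor W).lTensor M ∘ₗ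
      ρ.coactTensor W = LinearMap.id := by
  ext m w
  have h := congrArg (· ⊗ₜ[R] w) (LinearMap.congr_fun ρ.counit m)
  simp only [AlgebraTensorModule.curry_apply, curry_apply, restrictScalars_self, coactTensor,
    LinearMap.comp_apply, rTensor_tmul, LinearEquiv.coe_coe] at h ⊢
  refine Eq.trans ?_ h
  induction ρ.coact m with
  | zero => simp
  | add x y hx hy => simp only [map_add, TensorProduct.add_tmul, hx, hy]
  | tmul x y => simp [TensorProduct.smul_tmul]

theorem diag_diag_comp_assoc (k : M →ₗ[R] M ⊗[R] H) (l : N →ₗ[R] N ⊗[R] H)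
    (o : W →ₗ[R] W ⊗[R] H) :
    diag k (diag l o) ∘ₗ (TensorProduct.assoc R M N W).toLinearMap =
      (TensorProduct.assoc R M N W).toLinearMap.rTensor H ∘ₗ diag (diag k l) o := by
  apply TensorProduct.ext_threefold
  intro m n w
  obtain ⟨S, hS⟩ := TensorProduct.exists_finset (k m)
  obtain ⟨T, hT⟩ := TensorProduct.exists_finset (l n)
  obtain ⟨U, hU⟩ := TensorProduct.exists_finset (o w)
  simp only [diag, LinearMap.comp_apply, LinearEquiv.coe_coe, TensorProduct.assoc_tmul,
    TensorProduct.map_tmul, hS, hT, hU, TensorProduct.sum_tmul, TensorProduct.tmul_sum, map_sum,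
    TensorProduct.tensorTensorTensorComm_tmul, lTensor_tmul, mul'_apply, rTensor_tmul, mul_assoc]

theorem diag_comp_map {M' : Type u} [AddCommGroup M'] [Module R M'] {N' : Type u}
    [AddCommGroup N'] [Module R N'] {k : M →ₗ[R] M ⊗[R] H} {k' : M' →ₗ[R] M' ⊗[R] H}
    {l : N →ₗ[R] N ⊗[R] H} {l' : N' →ₗ[R] N' ⊗[R] H} {f : M →ₗ[R] M'} {g : N →ₗ[R] N'}
    (hf : k' ∘ₗ f = f.rTensor H ∘ₗ k) (hg : l' ∘ₗ g = g.rTensor H ∘ₗ l) :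
    diag k' l' ∘ₗ TensorProduct.map f g = (TensorProduct.map f g).rTensor H ∘ₗ diag k l := by
  have h : (mul' R H).lTensor (M' ⊗[R] N') ∘ₗ
      (TensorProduct.tensorTensorTensorComm R M' H N' H).toLinearMap ∘ₗ
        TensorProduct.map (f.rTensor H) (g.rTensor H) =
      (TensorProduct.map f g).rTensor H ∘ₗ (mul' R H).lTensor (M ⊗[R] N) ∘ₗ
        (TensorProduct.tensorTensorTensorComm R M H N H).toLinearMap := by
    apply TensorProduct.ext_fourfold'
    intro n h w k
    simp
  have h1 := congrArg (· ∘ₗ TensorProduct.map k l) h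
  simp only [LinearMap.comp_assoc, ← TensorProduct.map_comp] at h1
  simp only [diag, LinearMap.comp_assoc, ← TensorProduct.map_comp]
  rw [hf, hg, h1]

/-- Equivariance of the induced map `M ⊗ W → M ⊗ (C ⊗ W)`. -/
theorem RightComodule.diag_comp_coactTensor (ρ : RightComodule R C M) (α : HopfCoaction R H C)
    {k : M →ₗ[R] M ⊗[R] H} (hk : ρ.coact.rTensor H ∘ₗ k = diag k α.coact ∘ₗ ρ.coact)
    (o : W →ₗ[R] W ⊗[R] H) :
    diag k (diag α.coact o) ∘ₗ ρ.coactTensor W = (ρ.coactTensor W).rTensor H ∘ₗ diag k o := by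
  have h : diag (diag k α.coact) o ∘ₗ ρ.coact.rTensor W =
      (ρ.coact.rTensor W).rTensor H ∘ₗ diag k o :=
    diag_comp_map hk.symm (by rw [rTensor_id, LinearMap.comp_id, LinearMap.id_comp])
  rw [coactTensor, ← LinearMap.comp_assoc, diag_diag_comp_assoc, LinearMap.comp_assoc, h,
    rTensor_comp, LinearMap.comp_assoc]

/-- The cofree `H`-equivariant left `C`-comodule `C ⊗ W` on an `H`-comodule `W`. -/
def EquivariantLeftComodule.cofree (α : HopfCoaction R H C) (ω : RightComodule R H W) :
    EquivariantLeftComodule α (C ⊗[R] W) where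
  coact := (RightComodule.regular R C).coactTensor W
  coassoc := (RightComodule.regular R C).coactTensor_coassoc
  counit := by
    ext c w
    have h := congrArg (· ⊗ₜ[R] w) (congrArg (TensorProduct.lid R C)
      (Coalgebra.rTensor_counit_comul (R := R) c))
    rw [TensorProduct.lid_tmul, one_smul] at h
    refine Eq.trans ?_ h
    simp only [AlgebraTensorModule.curry_apply, curry_apply, restrictScalars_self,
      RightComodule.coactTensor, RightComodule.regular, LinearMap.comp_apply, rTensor_tmul,
      LinearEquiv.coe_coe]
    induction comul (R := R) c with
    | zero => simp
    | add x y hx hy => simp only [map_add, TensorProduct.add_tmul, hx, hy]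
    | tmul x y => simp [TensorProduct.smul_tmul']
  hopf := α.toRightComodule.tensor ω
  equivariant := ((RightComodule.regular R C).diag_comp_coactTensor α α.coflat.symm ω.coact).symm

theorem Bicomodule.tensorCoact_comp_coactTensor (B : Bicomodule R D C M) :
    B.left.tensorCoact (C ⊗[R] W) ∘ₗ B.right.coactTensor W =
      (B.right.coactTensor W).lTensor D ∘ₗ B.left.tensorCoact W := by
  ext m w
  have h := congrArg (((TensorProduct.mk R C W).flip w).lTensor M |>.lTensor D)
    (LinearMap.congr_fun B.comm m)
  simp only [AlgebraTensorModule.curry_apply, curry_apply, restrictScalars_self,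
    RightComodule.coactTensor, LeftComodule.tensorCoact,
    LinearMap.comp_apply, rTensor_tmul, LinearEquiv.coe_coe] at h ⊢
  refine Eq.trans ?_ (h.trans ?_)
  · induction B.right.coact m with
    | zero => simp
    | add x y hx hy => simp only [map_add, TensorProduct.add_tmul, hx, hy]
    | tmul x y =>
      simp only [rTensor_tmul, TensorProduct.assoc_tmul]
      induction B.left.coact x with
      | zero => simp
      | add x y hx hy => simp only [map_add, TensorProduct.add_tmul, hx, hy]
      | tmul x y => simp
  · induction B.left.coact m with
    | zero => simp
    | add x y hx hy => simp only [map_add, TensorProduct.add_tmul, hx, hy]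
    | tmul x y =>
      simp only [lTensor_tmul, TensorProduct.assoc_tmul, LinearMap.comp_apply, rTensor_tmul,
        LinearEquiv.coe_coe]
      congr 1
      induction B.right.coact y with
      | zero => simp
      | add x y hx hy => simp only [map_add, TensorProduct.add_tmul, hx, hy]
      | tmul x y => simp

end Cofree

/-! ### The universal property of `C` -/

section Universal

variable {R : Type u} [CommRing R] {H : Type u} [Ring H] [HopfAlgebra R H]
  {C : Type u} [AddCommGroup C] [Module R C] [Coalgebra R C]
  {D : Type u} [AddCommGroup D] [Module R D] [Coalgebra R D]
  {M : Type u} [AddCommGroup M] [Module R M] {A : Type u} [Ring A] [Algebra R A]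
  {W : Type u} [AddCommGroup W] [Module R W]
  {β : HopfCoaction R H D} {α : HopfCoaction R H C} {B : Bicomodule R D C M}

theorem EquivariantLeftComodule.IsHom.comp {X Y Z : Type u} [AddCommGroup X] [Module R X]
    [AddCommGroup Y] [Module R Y] [AddCommGroup Z] [Module R Z]
    {x : EquivariantLeftComodule α X} {y : EquivariantLeftComodule α Y}
    {z : EquivariantLeftComodule α Z} {g : Y →ₗ[R] Z} {f : X →ₗ[R] Y} (hg : y.IsHom z g)
    (hf : x.IsHom y f) : x.IsHom z (g ∘ₗ f) := by
  obtain ⟨hg₁, hg₂⟩ := hg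
  obtain ⟨hf₁, hf₂⟩ := hf
  rw [LeftComodule.IsHom] at hg₁ hf₁
  rw [RightComodule.IsHom] at hg₂ hf₂
  constructor
  · rw [LeftComodule.IsHom, ← LinearMap.comp_assoc, hg₁, LinearMap.comp_assoc, hf₁, lTensor_comp,
      LinearMap.comp_assoc]
  · rw [RightComodule.IsHom, ← LinearMap.comp_assoc, hg₂, LinearMap.comp_assoc, hf₂, rTensor_comp,
      LinearMap.comp_assoc]

theorem EquivariantLeftComodule.IsHom.symm {X Y : Type u} [AddCommGroup X] [Module R X]
    [AddCommGroup Y] [Module R Y] {x : EquivariantLeftComodule α X}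
    {y : EquivariantLeftComodule α Y} {e : X ≃ₗ[R] Y} (he : x.IsHom y e.toLinearMap) :
    y.IsHom x e.symm.toLinearMap := by
  obtain ⟨h₁, h₂⟩ := he
  rw [LeftComodule.IsHom] at h₁
  rw [RightComodule.IsHom] at h₂
  have hs : e.symm.toLinearMap ∘ₗ e.toLinearMap = LinearMap.id := by ext; simp
  constructor
  · ext c
    obtain ⟨c, rfl⟩ := e.surjective c
    have h := congrArg (e.symm.toLinearMap.lTensor C) (LinearMap.congr_fun h₁ c)
    simp only [LinearMap.comp_apply, ← lTensor_comp_apply, hs, lTensor_id] at h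
    simpa using h.symm
  · ext c
    obtain ⟨c, rfl⟩ := e.surjective c
    have h := congrArg (e.symm.toLinearMap.rTensor H) (LinearMap.congr_fun h₂ c)
    simp only [LinearMap.comp_apply, ← rTensor_comp_apply, hs, rTensor_id] at h
    simpa using h.symm

namespace EquivariantCoaction

/-- For a quasi-finite bicomodule with canonical coendomorphism coalgebra, the structure map
`M → M ⊗ C` is itself a universal arrow. -/
theorem isCoHom_regular {δ : EquivariantCoaction β α B} (hq : δ.IsQuasiFinite)
    (hc : δ.CoEndIsCanonical) :
    δ.IsCoHom δ.asLeft (EquivariantLeftComodule.regular α) B.right.coact := by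
  have hreg : δ.IsCotensorHom δ.asLeft (EquivariantLeftComodule.regular α) B.right.coact :=
    ⟨B.right.coassoc, B.comm, δ.right_equivariant.symm⟩
  obtain ⟨X, _, _, x, η, hη⟩ := hq M δ.asLeft
  obtain ⟨g, ⟨hg, hgη⟩, -⟩ := hη.2 C (EquivariantLeftComodule.regular α) _ hreg
  set e := LinearEquiv.ofBijective g (hc X x η g hη hg hgη) with he
  have heg : e.toLinearMap = g := rfl
  rw [← heg] at hg hgη
  have hs : e.symm.toLinearMap ∘ₗ e.toLinearMap = LinearMap.id := by ext; simp
  have hs' : e.toLinearMap ∘ₗ e.symm.toLinearMap = LinearMap.id := by ext; simp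
  refine ⟨hreg, fun Z _ _ z f hf => ?_⟩
  obtain ⟨k, ⟨hk, hkη⟩, huniq⟩ := hη.2 Z z f hf
  refine ⟨k ∘ₗ e.symm.toLinearMap, ⟨hk.comp hg.symm, ?_⟩, fun k' ⟨hk', hkη'⟩ => ?_⟩
  · rw [← hgη, ← LinearMap.comp_assoc, ← lTensor_comp, LinearMap.comp_assoc, hs, LinearMap.comp_id,
      hkη]
  · rw [← huniq (k' ∘ₗ e.toLinearMap) ⟨hk'.comp hg, by
      rw [lTensor_comp, LinearMap.comp_assoc, hgη, hkη']⟩, LinearMap.comp_assoc, hs',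
      LinearMap.comp_id]

/-- A `D`- and `H`-colinear map `M → M ⊗ W` gives a morphism from `M` to the cotensor product of
`M` with the cofree comodule `C ⊗ W`. -/
theorem isCotensorHom_cofree (δ : EquivariantCoaction β α B) (ω : RightComodule R H W)
    {F : M →ₗ[R] M ⊗[R] W} (hD : B.left.tensorCoact W ∘ₗ F = F.lTensor D ∘ₗ B.left.coact)
    (hH : diag δ.coact ω.coact ∘ₗ F = F.rTensor H ∘ₗ δ.coact) :
    δ.IsCotensorHom δ.asLeft (EquivariantLeftComodule.cofree α ω) (B.right.coactTensor W ∘ₗ F) where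
  cotensor := by
    have h := congrArg (· ∘ₗ F) (B.right.coactTensor_coassoc (W := W))
    exact h
  colinear := by
    have h := congrArg (· ∘ₗ F) (B.tensorCoact_comp_coactTensor (W := W))
    simp only [LinearMap.comp_assoc, hD] at h
    rw [lTensor_comp]
    exact h
  hopf_colinear := by
    have h := congrArg (· ∘ₗ F)
      (B.right.diag_comp_coactTensor α δ.right_equivariant ω.coact)
    simp only [LinearMap.comp_assoc, hH] at h
    rw [rTensor_comp]
    exact h

/-- Division of one coaction by another: if `f` is `D`-colinear, then so is `δ⁻¹ f δ'`. -/
theorem isColinear_inv_mul_mul (δ δ' : EquivariantCoaction β α B) (j : H →ₐ[R] A)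
    {f : KleisliEnd R A M} (hf : B.left.IsColinear 1 f)
    (hc : (β.toRightComodule.unitMap j).val.slide M ∘ₗ f.extend.lTensor D =
      f.extend.lTensor D ∘ₗ (β.toRightComodule.unitMap j).val.slide M) :
    B.left.IsColinear 1 ((δ.toRightComodule.unitMap j)⁻¹.val *
      (f * (δ'.toRightComodule.unitMap j).val)) := by
  refine (δ.isColinear_unitMap j).of_mul (β.toRightComodule.unitMap j) _ ?_
  rw [Units.mul_inv_cancel_left]
  have h := hf.mul (δ'.isColinear_unitMap j) hc
  rwa [one_mul] at h

/-- The `D`- and `H`-colinear map `M → M ⊗ (A ⊗ H)` that corresponds to the `D`-colinear map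
`f : M → M ⊗ A`; it is `m ↦ f(m⁽⁰⁾)⁽⁰⁾ ⊗ S(f(m⁽⁰⁾)⁽¹⁾) m⁽¹⁾`, where `H` coacts on the factor `M`
of `M ⊗ A`. -/
def cofreeLift (δ : EquivariantCoaction β α B) (f : KleisliEnd R A M) :
    KleisliEnd R (A ⊗[R] H) M :=
  (δ.toRightComodule.unitMap Algebra.TensorProduct.includeRight)⁻¹.val *
    (f.map Algebra.TensorProduct.includeLeft *
      (δ.toRightComodule.unitMap Algebra.TensorProduct.includeRight).val)

theorem isColinear_cofreeLift (δ : EquivariantCoaction β α B) {f : KleisliEnd R A M}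
    (hf : B.left.IsColinear 1 f) : B.left.IsColinear 1 (δ.cofreeLift f) := by
  refine δ.isColinear_inv_mul_mul δ _ ?_ (KleisliEnd.slide_includeRight_comp _ f)
  have h := hf.map (Algebra.TensorProduct.includeLeft : A →ₐ[R] A ⊗[R] H)
  rwa [map_one] at h

/-- The operator `m ⊗ (a ⊗ h) ↦ m⁽⁰⁾ ⊗ (a ⊗ m⁽¹⁾ h)` intertwines the diagonal coaction with the
coaction on the last factor. -/
theorem rTensor_extend_comp_diag (δ : RightComodule R H M) :
    ((δ.unitMap (Algebra.TensorProduct.includeRight : H →ₐ[R] A ⊗[R] H)).val.extend).rTensor H ∘ₗ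
        diag δ.coact (RightComodule.cofree H A (R := R)).coact =
      (TensorProduct.assoc R M (A ⊗[R] H) H).symm.toLinearMap ∘ₗ
        (RightComodule.cofree H A (R := R)).coact.lTensor M ∘ₗ
          (δ.unitMap (Algebra.TensorProduct.includeRight : H →ₐ[R] A ⊗[R] H)).val.extend := by
  apply TensorProduct.ext_threefold'
  intro m a h
  obtain ⟨T, hT⟩ := TensorProduct.exists_finset (comul (R := R) h)
  -- both sides are obtained from `m⁽⁰⁾ ⊗ (m⁽¹⁾ ⊗ m⁽²⁾)` by the same map `Q`
  set Q : M ⊗[R] (H ⊗[R] H) →ₗ[R] (M ⊗[R] (A ⊗[R] H)) ⊗[R] H :=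
    (TensorProduct.assoc R M (A ⊗[R] H) H).symm.toLinearMap ∘ₗ
      ((TensorProduct.assoc R A H H).symm.toLinearMap ∘ₗ TensorProduct.mk R A (H ⊗[R] H) a ∘ₗ
        mulRight R (comul (R := R) h)).lTensor M with hQ
  have h1 : ∀ t : M ⊗[R] H,
      (((δ.unitMap (Algebra.TensorProduct.includeRight : H →ₐ[R] A ⊗[R] H)).val.extend).rTensor H)
        ((mul' R H).lTensor (M ⊗[R] (A ⊗[R] H))
          (TensorProduct.tensorTensorTensorComm R M H (A ⊗[R] H) H
            (t ⊗ₜ (RightComodule.cofree H A (R := R)).coact (a ⊗ₜ h)))) =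
      Q (TensorProduct.assoc R M H H (δ.coact.rTensor H t)) := by
    intro t
    induction t with
    | zero => simp
    | add x y hx hy => simp only [map_add, TensorProduct.add_tmul, hx, hy]
    | tmul n k =>
      obtain ⟨S, hS⟩ := TensorProduct.exists_finset (δ.coact n)
      simp only [hQ, RightComodule.coact_cofree_tmul, hT, hS, TensorProduct.tmul_sum,
        TensorProduct.sum_tmul, map_sum, TensorProduct.assoc_symm_tmul, TensorProduct.assoc_tmul,
        TensorProduct.tensorTensorTensorComm_tmul, lTensor_tmul, rTensor_tmul, mul'_apply,
        KleisliEnd.extend_tmul, RightComodule.toLin_unitMap, LinearMap.comp_apply,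
        LinearEquiv.coe_coe, mulRight_apply, AlgHom.toLinearMap_apply,
        Algebra.TensorProduct.includeRight_apply, Algebra.TensorProduct.tmul_mul_tmul, one_mul,
        TensorProduct.mk_apply, Finset.mul_sum]
      rw [Finset.sum_comm]
  have h2 : ∀ t : M ⊗[R] H,
      (TensorProduct.assoc R M (A ⊗[R] H) H).symm
        ((RightComodule.cofree H A (R := R)).coact.lTensor M
          ((mulRight R (a ⊗ₜ[R] h)).lTensor M
            ((Algebra.TensorProduct.includeRight : H →ₐ[R] A ⊗[R] H).toLinearMap.lTensor M t))) =
      Q ((comul (R := R) (A := H)).lTensor M t) := by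
    intro t
    induction t with
    | zero => simp
    | add x y hx hy => simp only [map_add, hx, hy]
    | tmul n k =>
      simp only [hQ, lTensor_tmul, AlgHom.toLinearMap_apply,
        Algebra.TensorProduct.includeRight_apply, mulRight_apply, LinearMap.comp_apply,
        Algebra.TensorProduct.tmul_mul_tmul, one_mul, RightComodule.coact_cofree_tmul,
        Bialgebra.comul_mul, LinearEquiv.coe_coe, TensorProduct.mk_apply]
  have h3 := LinearMap.congr_fun δ.coassoc m
  simp only [LinearMap.comp_apply, LinearEquiv.coe_coe] at h3
  simp only [LinearMap.comp_apply, LinearEquiv.coe_coe, KleisliEnd.extend_tmul,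
    RightComodule.toLin_unitMap, diag, TensorProduct.map_tmul] at h1 h2 ⊢
  rw [h1, h2, h3]

theorem diag_comp_cofreeLift (δ : EquivariantCoaction β α B) (f : KleisliEnd R A M) :
    diag δ.coact (RightComodule.cofree H A (R := R)).coact ∘ₗ (δ.cofreeLift f).toLin =
      (δ.cofreeLift f).toLin.rTensor H ∘ₗ δ.coact := by
  set E := δ.toRightComodule.unitMap
    (Algebra.TensorProduct.includeRight : H →ₐ[R] A ⊗[R] H) with hE
  have hEF : E.val.extend ∘ₗ (δ.cofreeLift f).toLin =
      (TensorProduct.assoc R M A H).toLinearMap ∘ₗ f.toLin.rTensor H ∘ₗ δ.coact := by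
    rw [← KleisliEnd.toLin_mul, cofreeLift, Units.mul_inv_cancel_left, KleisliEnd.toLin_mul,
      ← LinearMap.comp_assoc, KleisliEnd.assoc_comp_rTensor]
    rfl
  have hω : (TensorProduct.assoc R M (A ⊗[R] H) H).symm.toLinearMap ∘ₗ
      (RightComodule.cofree H A (R := R)).coact.lTensor M ∘ₗ
        (TensorProduct.assoc R M A H).toLinearMap ∘ₗ f.toLin.rTensor H =
      ((TensorProduct.assoc R M A H).toLinearMap ∘ₗ f.toLin.rTensor H).rTensor H ∘ₗ
        (TensorProduct.assoc R M H H).symm.toLinearMap ∘ₗ (comul (R := R) (A := H)).lTensor M := by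
    ext m h
    obtain ⟨S, hS⟩ := TensorProduct.exists_finset (f.toLin m)
    obtain ⟨T, hT⟩ := TensorProduct.exists_finset (comul (R := R) h)
    simp only [AlgebraTensorModule.curry_apply, curry_apply, restrictScalars_self,
      LinearMap.comp_apply, LinearEquiv.coe_coe, rTensor_tmul, lTensor_tmul, hS, hT,
      TensorProduct.sum_tmul, TensorProduct.tmul_sum, map_sum, TensorProduct.assoc_tmul,
      TensorProduct.assoc_symm_tmul, RightComodule.coact_cofree_tmul]
    rw [Finset.sum_comm]
  have hδ : (TensorProduct.assoc R M H H).symm.toLinearMap ∘ₗ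
      (comul (R := R) (A := H)).lTensor M ∘ₗ δ.coact = δ.coact.rTensor H ∘ₗ δ.coact := by
    rw [← δ.coassoc]
    ext m
    simp
  -- compare after the invertible operator `E ⊗ id`
  have hinj : (E⁻¹.val.extend).rTensor H ∘ₗ (E.val.extend).rTensor H = LinearMap.id := by
    rw [← rTensor_comp, KleisliEnd.extend_comp_extend E.inv_mul, rTensor_id]
  have key : (E.val.extend).rTensor H ∘ₗ
        diag δ.coact (RightComodule.cofree H A (R := R)).coact ∘ₗ (δ.cofreeLift f).toLin =
      (E.val.extend).rTensor H ∘ₗ (δ.cofreeLift f).toLin.rTensor H ∘ₗ δ.coact := by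
    rw [← LinearMap.comp_assoc, rTensor_extend_comp_diag, LinearMap.comp_assoc,
      LinearMap.comp_assoc, ← hE, hEF, ← LinearMap.comp_assoc _ _ (LinearMap.rTensor H _),
      ← rTensor_comp, hEF]
    have h := congrArg (· ∘ₗ δ.coact) hω
    simp only [LinearMap.comp_assoc, hδ] at h
    rw [h]
    simp only [rTensor_comp, LinearMap.comp_assoc]
  have h := congrArg ((E⁻¹.val.extend).rTensor H ∘ₗ ·) key
  simpa only [← LinearMap.comp_assoc, hinj, LinearMap.id_comp] using h

theorem cofreeLift_convHom (δ : EquivariantCoaction β α B) (g : WithConv (C →ₗ[R] A)) :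
    δ.cofreeLift (B.right.convHom g) = B.right.convHom (α.push g) := by
  rw [cofreeLift, Units.inv_mul_eq_iff_eq_mul]
  exact B.right.map_convHom_mul α δ.toRightComodule.unit.val δ.right_equivariant g

end EquivariantCoaction

end Universal

section Coendomorphisms

variable {R : Type u} [CommRing R] {H : Type u} [Ring H] [HopfAlgebra R H]
  {C : Type u} [AddCommGroup C] [Module R C] [Coalgebra R C]
  {D : Type u} [AddCommGroup D] [Module R D] [Coalgebra R D]
  {M : Type u} [AddCommGroup M] [Module R M] {A : Type u} [Ring A] [Algebra R A]
  {W : Type u} [AddCommGroup W] [Module R W]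
  {β : HopfCoaction R H D} {α : HopfCoaction R H C} {B : Bicomodule R D C M}

theorem commute_ofId_counit (a : A) (h : H) : Commute (AlgHom.id R A a)
    ((Algebra.ofId R A).comp (Bialgebra.counitAlgHom R H) h) :=
  (Algebra.commutes (counit (R := R) h) a).symm

/-- The algebra homomorphism `a ⊗ h ↦ a ε(h)`. -/
def counitRight (R H A : Type u) [CommRing R] [Ring H] [HopfAlgebra R H] [Ring A] [Algebra R A] :
    A ⊗[R] H →ₐ[R] A :=
  Algebra.TensorProduct.lift (AlgHom.id R A)
    ((Algebra.ofId R A).comp (Bialgebra.counitAlgHom R H))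
    commute_ofId_counit

theorem counitRight_comp_includeLeft :
    (counitRight R H A).comp Algebra.TensorProduct.includeLeft = AlgHom.id R A :=
  Algebra.TensorProduct.lift_comp_includeLeft _ _ commute_ofId_counit

theorem counitRight_comp_includeRight :
    (counitRight R H A).comp Algebra.TensorProduct.includeRight =
      (Algebra.ofId R A).comp (Bialgebra.counitAlgHom R H) :=
  Algebra.TensorProduct.lift_comp_includeRight _ _ commute_ofId_counit

/-- A map is recovered from its cofree lift by the counit of `H`. -/
theorem map_counitRight_cofreeLift (δ : EquivariantCoaction β α B) (f : KleisliEnd R A M) :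
    (δ.cofreeLift f).map (counitRight R H A) = f := by
  have h : Units.map (KleisliEnd.map (counitRight R H A))
      (δ.toRightComodule.unitMap Algebra.TensorProduct.includeRight) = 1 := by
    rw [RightComodule.map_unitMap, counitRight_comp_includeRight, ← RightComodule.map_unitMap,
      RightComodule.unitMap_counit, map_one]
  have h1 := congrArg Units.val h
  have h2 := congrArg (fun x => (x⁻¹).val) h
  simp only [← map_inv, Units.coe_map, Units.val_one, inv_one] at h1 h2
  rw [EquivariantCoaction.cofreeLift, map_mul, map_mul]
  refine (congrArg₂ (· * ·) h2 (congrArg₂ (· * ·) rfl h1)).trans ?_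
  rw [KleisliEnd.map_map, counitRight_comp_includeLeft, KleisliEnd.map_id, one_mul, mul_one]

theorem RightComodule.coactTensor_comp_lTensor (ρ : RightComodule R C M) (g : C →ₗ[R] W) :
    ρ.coactTensor W ∘ₗ g.lTensor M ∘ₗ ρ.coact =
      (g.lTensor C ∘ₗ comul).lTensor M ∘ₗ ρ.coact := by
  have h : ρ.coactTensor W ∘ₗ g.lTensor M =
      (g.lTensor C).lTensor M ∘ₗ (TensorProduct.assoc R M C C).toLinearMap ∘ₗ
        ρ.coact.rTensor C := by
    ext m c
    obtain ⟨S, hS⟩ := TensorProduct.exists_finset (ρ.coact m)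
    simp [RightComodule.coactTensor, hS, TensorProduct.sum_tmul]
  rw [← LinearMap.comp_assoc, h, LinearMap.comp_assoc, LinearMap.comp_assoc, ρ.coassoc,
    ← LinearMap.comp_assoc, ← lTensor_comp]

/-- An `H`-colinear map `C → W` extends to a morphism from `C` to the cofree comodule `C ⊗ W`. -/
theorem isHom_cofree (α : HopfCoaction R H C) (ω : RightComodule R H W) {g : C →ₗ[R] W}
    (hg : ω.coact ∘ₗ g = g.rTensor H ∘ₗ α.coact) :
    (EquivariantLeftComodule.regular α).IsHom (EquivariantLeftComodule.cofree α ω)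
      (g.lTensor C ∘ₗ comul) := by
  constructor
  · exact (RightComodule.regular R C).coactTensor_comp_lTensor g
  · have h : diag α.coact ω.coact ∘ₗ g.lTensor C = (g.lTensor C).rTensor H ∘ₗ
        diag α.coact α.coact :=
      diag_comp_map (by rw [rTensor_id, LinearMap.comp_id, LinearMap.id_comp]) hg
    have h1 := congrArg (· ∘ₗ comul (R := R) (A := C)) h
    simp only [LinearMap.comp_assoc, α.coflat] at h1
    rw [RightComodule.IsHom, rTensor_comp, LinearMap.comp_assoc]
    exact h1

theorem cofree_comp_push (α : HopfCoaction R H C) (g : WithConv (C →ₗ[R] A)) :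
    (RightComodule.cofree H A (R := R)).coact ∘ₗ (α.push g).ofConv =
      (α.push g).ofConv.rTensor H ∘ₗ α.coact := by
  have h : (RightComodule.cofree H A (R := R)).coact ∘ₗ g.ofConv.rTensor H =
      (g.ofConv.rTensor H).rTensor H ∘ₗ (TensorProduct.assoc R C H H).symm.toLinearMap ∘ₗ
        (comul (R := R) (A := H)).lTensor C := by
    ext c h
    obtain ⟨S, hS⟩ := TensorProduct.exists_finset (comul (R := R) h)
    simp [RightComodule.coact_cofree_tmul, hS, TensorProduct.tmul_sum]
  have h1 : (TensorProduct.assoc R C H H).symm.toLinearMap ∘ₗ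
      (comul (R := R) (A := H)).lTensor C ∘ₗ α.coact = α.coact.rTensor H ∘ₗ α.coact := by
    rw [← α.coassoc]
    ext m
    simp
  have h2 := congrArg (· ∘ₗ α.coact) h
  simp only [LinearMap.comp_assoc, h1] at h2
  rw [HopfCoaction.push, rTensor_comp, LinearMap.comp_assoc]
  exact h2

theorem counitRight_comp_push (α : HopfCoaction R H C) (g : WithConv (C →ₗ[R] A)) :
    (counitRight R H A).toLinearMap ∘ₗ (α.push g).ofConv = g.ofConv := by
  have h : (counitRight R H A).toLinearMap ∘ₗ g.ofConv.rTensor H =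
      g.ofConv ∘ₗ (TensorProduct.rid R C).toLinearMap ∘ₗ
        (Coalgebra.counit (R := R) (A := H)).lTensor C := by
    ext c h
    simp only [AlgebraTensorModule.curry_apply, curry_apply, restrictScalars_self,
      LinearMap.comp_apply, rTensor_tmul, lTensor_tmul, AlgHom.toLinearMap_apply, counitRight,
      Algebra.TensorProduct.lift_tmul, LinearEquiv.coe_coe, TensorProduct.rid_tmul, map_smul,
      AlgHom.comp_apply, AlgHom.id_apply, Algebra.ofId_apply, Bialgebra.counitAlgHom_apply]
    rw [← Algebra.commutes, ← Algebra.smul_def]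
  have h2 := congrArg (· ∘ₗ α.coact) h
  simp only [LinearMap.comp_assoc, α.counit, LinearMap.comp_id] at h2
  exact h2

namespace EquivariantCoaction

variable {δ₀ : EquivariantCoaction β α B}

/-- Every `D`-colinear map `f : M → M ⊗ A` is of the form `m ↦ m₍₀₎ ⊗ g(m₍₁₎)`. The map `g` is
obtained by applying the universal property of `C` to the cofree lift of `f`, followed by the
counits of `C` and `H`. -/
theorem exists_convHom_eq
    (h₀ : δ₀.IsCoHom δ₀.asLeft (EquivariantLeftComodule.regular α) B.right.coact)
    {f : KleisliEnd R A M} (hf : B.left.IsColinear 1 f) :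
    ∃ g : WithConv (C →ₗ[R] A), B.right.convHom g = f := by
  have hD := δ₀.isColinear_cofreeLift hf
  rw [LeftComodule.IsColinear, KleisliEnd.slide_one, LinearMap.id_comp] at hD
  obtain ⟨g, ⟨-, hg⟩, -⟩ := h₀.2 _ _ _ (δ₀.isCotensorHom_cofree
    (RightComodule.cofree H A) hD (δ₀.diag_comp_cofreeLift f))
  refine ⟨toConv ((counitRight R H A).toLinearMap ∘ₗ (TensorProduct.lid R (A ⊗[R] H)).toLinearMap ∘ₗ
    (Coalgebra.counit (R := R) (A := C)).rTensor (A ⊗[R] H) ∘ₗ g), ?_⟩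
  have h1 : (B.right.convHom (toConv ((TensorProduct.lid R (A ⊗[R] H)).toLinearMap ∘ₗ
      (Coalgebra.counit (R := R) (A := C)).rTensor (A ⊗[R] H) ∘ₗ g))) = δ₀.cofreeLift f := by
    ext1
    rw [RightComodule.toLin_convHom]
    have h2 := congrArg (((TensorProduct.lid R (A ⊗[R] H)).toLinearMap ∘ₗ
      (Coalgebra.counit (R := R) (A := C)).rTensor (A ⊗[R] H)).lTensor M ∘ₗ ·) hg
    rw [← LinearMap.comp_assoc, ← lTensor_comp, ← LinearMap.comp_assoc,
      B.right.coactTensor_counit, LinearMap.id_comp] at h2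
    exact h2
  rw [← map_counitRight_cofreeLift δ₀ f, ← h1, RightComodule.map_convHom]

theorem convHom_injective
    (h₀ : δ₀.IsCoHom δ₀.asLeft (EquivariantLeftComodule.regular α) B.right.coact) :
    Function.Injective (B.right.convHom (A := A)) := by
  intro g g' h
  have hD := δ₀.isColinear_cofreeLift (B.isColinear_convHom g)
  rw [LeftComodule.IsColinear, KleisliEnd.slide_one, LinearMap.id_comp] at hD
  have hex := h₀.2 _ _ _ (δ₀.isCotensorHom_cofree
    (RightComodule.cofree H A) hD (δ₀.diag_comp_cofreeLift _))
  -- the extensions of `g` and `g'` to morphisms `C → C ⊗ (A ⊗ H)` agree by uniqueness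
  have h1 := hex.unique (y₁ := (α.push g).ofConv.lTensor C ∘ₗ comul)
    (y₂ := (α.push g').ofConv.lTensor C ∘ₗ comul)
    ⟨isHom_cofree α _ (cofree_comp_push α g), by
      rw [← B.right.coactTensor_comp_lTensor, cofreeLift_convHom, RightComodule.toLin_convHom]⟩
    ⟨isHom_cofree α _ (cofree_comp_push α g'), by
      rw [← B.right.coactTensor_comp_lTensor, h, cofreeLift_convHom,
        RightComodule.toLin_convHom]⟩
  have h2 : ∀ k : C →ₗ[R] A ⊗[R] H, (TensorProduct.lid R (A ⊗[R] H)).toLinearMap ∘ₗ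
      (Coalgebra.counit (R := R) (A := C)).rTensor (A ⊗[R] H) ∘ₗ k.lTensor C ∘ₗ comul = k := by
    intro k
    ext c
    have h3 := congrArg (TensorProduct.lid R (A ⊗[R] H)) (congrArg (k.lTensor R)
      (Coalgebra.rTensor_counit_comul (R := R) c))
    rw [← LinearMap.comp_apply (k.lTensor R), lTensor_comp_rTensor,
      ← rTensor_comp_lTensor] at h3
    rw [lTensor_tmul, TensorProduct.lid_tmul, one_smul] at h3
    exact h3
  have h3 : (α.push g).ofConv = (α.push g').ofConv := by
    rw [← h2 (α.push g).ofConv, h1, h2]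
  apply WithConv.ext
  rw [← counitRight_comp_push α g, h3, counitRight_comp_push]

end EquivariantCoaction

end Coendomorphisms

/-! ### Twisting coactions by cocharacters -/

section Twist

variable {R : Type u} [CommRing R] {H : Type u} [Ring H] [HopfAlgebra R H]
  {C : Type u} [AddCommGroup C] [Module R C] [Coalgebra R C]
  {D : Type u} [AddCommGroup D] [Module R D] [Coalgebra R D]
  {M : Type u} [AddCommGroup M] [Module R M] {A : Type u} [Ring A] [Algebra R A]
  {β : HopfCoaction R H D} {α : HopfCoaction R H C} {B : Bicomodule R D C M}

/-- Coassociativity of a map `k : M → M ⊗ H`, in the Kleisli monoid over `H ⊗ H`. -/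
theorem coassoc_iff (k : KleisliEnd R H M) :
    (TensorProduct.assoc R M H H).toLinearMap ∘ₗ k.toLin.rTensor H ∘ₗ k.toLin =
        (comul (R := R) (A := H)).lTensor M ∘ₗ k.toLin ↔
      k.map (Algebra.TensorProduct.includeLeft : H →ₐ[R] H ⊗[R] H) *
          k.map (Algebra.TensorProduct.includeRight : H →ₐ[R] H ⊗[R] H) =
        k.map (Bialgebra.comulAlgHom R H) := by
  rw [← LinearMap.comp_assoc, KleisliEnd.assoc_comp_rTensor, KleisliEnd.ext_iff]
  rfl

theorem counit_iff (k : KleisliEnd R H M) :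
    (TensorProduct.rid R M).toLinearMap ∘ₗ (counit (R := R) (A := H)).lTensor M ∘ₗ k.toLin =
      LinearMap.id ↔ k.map (Bialgebra.counitAlgHom R H) = 1 := by
  rw [KleisliEnd.ext_iff, LinearMap.ext_iff, LinearMap.ext_iff]
  refine forall_congr' fun m => ?_
  rw [← (TensorProduct.rid R M).injective.eq_iff, KleisliEnd.toLin_one, TensorProduct.rid_tmul,
    one_smul]
  rfl

theorem toConv_counit :
    toConv (counit (R := R) (A := C)) = (1 : WithConv (C →ₗ[R] R)) := by
  apply WithConv.ext; ext c; simp [LinearMap.convOne_def]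

namespace EquivariantCoaction

theorem unit_injective :
    Function.Injective fun δ : EquivariantCoaction β α B => δ.toRightComodule.unit.val := by
  intro δ δ' h
  have h1 : δ.coact = δ'.coact := congrArg KleisliEnd.toLin h
  cases δ with | mk ρ _ _ =>
  cases δ' with | mk ρ' _ _ =>
  have h2 : ρ = ρ' := RightComodule.ext h1
  subst h2
  rfl

theorem twirl_eq (δ : EquivariantCoaction β α B) (φ : WithConv (C →ₗ[R] H)) :
    δ.twirl φ.ofConv = (δ.toRightComodule.unit.val * B.right.convHom φ).toLin := by
  rw [twirl, ← rTensor_comp_lTensor]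
  rfl

theorem map_convHom_mul_unitMap (δ : EquivariantCoaction β α B) (g : WithConv (C →ₗ[R] A)) :
    (B.right.convHom g).map (Algebra.TensorProduct.includeLeft : A →ₐ[R] A ⊗[R] H) *
        (δ.toRightComodule.unitMap Algebra.TensorProduct.includeRight).val =
      (δ.toRightComodule.unitMap Algebra.TensorProduct.includeRight).val *
        B.right.convHom (α.push g) :=
  B.right.map_convHom_mul α δ.toRightComodule.unit.val δ.right_equivariant g

/-- The composite of a twisted coaction with itself. -/
theorem map_twist_mul_map_twist (δ : EquivariantCoaction β α B) (φ : WithConv (C →ₗ[R] H)) :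
    (δ.toRightComodule.unit.val * B.right.convHom φ).map
          (Algebra.TensorProduct.includeLeft : H →ₐ[R] H ⊗[R] H) *
        (δ.toRightComodule.unit.val * B.right.convHom φ).map
          (Algebra.TensorProduct.includeRight : H →ₐ[R] H ⊗[R] H) =
      (δ.toRightComodule.unitMap (Bialgebra.comulAlgHom R H)).val *
        B.right.convHom (α.push φ * convIncl R H C H φ) := by
  have h := δ.map_convHom_mul_unitMap φ
  rw [RightComodule.map_convHom] at h
  rw [← δ.unitMap_mul_unitMap, map_mul, map_mul, RightComodule.map_convHom,
    RightComodule.map_convHom, map_mul, Units.val_mul, mul_assoc, mul_assoc,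
    ← mul_assoc _ (B.right.convHom (α.push φ)), ← h]
  simp only [mul_assoc]
  rfl

theorem map_twist_comul (δ : EquivariantCoaction β α B) (φ : WithConv (C →ₗ[R] H)) :
    (δ.toRightComodule.unit.val * B.right.convHom φ).map (Bialgebra.comulAlgHom R H) =
      (δ.toRightComodule.unitMap (Bialgebra.comulAlgHom R H)).val *
        B.right.convHom (toConv (comul ∘ₗ φ.ofConv)) := by
  rw [map_mul, RightComodule.map_convHom]
  rfl

theorem map_twist_counit (δ : EquivariantCoaction β α B) (φ : WithConv (C →ₗ[R] H)) :
    (δ.toRightComodule.unit.val * B.right.convHom φ).map (Bialgebra.counitAlgHom R H) =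
      B.right.convHom (toConv (counit ∘ₗ φ.ofConv)) := by
  have h := congrArg Units.val δ.unitMap_counit
  rw [map_mul, RightComodule.map_convHom]
  refine (congrArg (· * _) h).trans ?_
  rw [Units.val_one, one_mul]
  rfl

/-- The two sides of the equivariance of a twisted coaction over `C` are computed here and in
`map_twist_mul_convHom`. -/
theorem map_convHom_mul_twist (δ : EquivariantCoaction β α B) (φ : WithConv (C →ₗ[R] H))
    (g : WithConv (C →ₗ[R] A)) :
    (B.right.convHom g).map (Algebra.TensorProduct.includeLeft : A →ₐ[R] A ⊗[R] H) *
        (δ.toRightComodule.unit.val * B.right.convHom φ).map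
          (Algebra.TensorProduct.includeRight : H →ₐ[R] A ⊗[R] H) =
      (δ.toRightComodule.unitMap Algebra.TensorProduct.includeRight).val *
        B.right.convHom (α.push g * convIncl R H C A φ) := by
  rw [map_mul, ← mul_assoc]
  erw [δ.map_convHom_mul_unitMap g]
  rw [map_mul, RightComodule.map_convHom, mul_assoc]
  rfl

theorem map_twist_mul_convHom (δ : EquivariantCoaction β α B) (φ : WithConv (C →ₗ[R] H))
    (g : WithConv (C →ₗ[R] A)) :
    (δ.toRightComodule.unit.val * B.right.convHom φ).map
          (Algebra.TensorProduct.includeRight : H →ₐ[R] A ⊗[R] H) *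
        B.right.convHom (α.push g) =
      (δ.toRightComodule.unitMap Algebra.TensorProduct.includeRight).val *
        B.right.convHom (convIncl R H C A φ * α.push g) := by
  rw [map_mul, map_mul, RightComodule.map_convHom, mul_assoc]
  rfl

/-- The equivariant bicomodule obtained from `δ` by twisting with a cocharacter. -/
def twist (δ : EquivariantCoaction β α B) (φ : WithConv (C →ₗ[R] H))
    (hφ : IsCocharacter α φ.ofConv) : EquivariantCoaction β α B where
  coact := δ.twirl φ.ofConv
  coassoc := by
    rw [twirl_eq]
    refine (coassoc_iff _).2 ?_
    rw [map_twist_mul_map_twist, map_twist_comul, (coaction_iff α φ).1 hφ.coaction]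
  counit := by
    rw [twirl_eq]
    refine (counit_iff _).2 ?_
    rw [map_twist_counit, hφ.counit_comp, toConv_counit, map_one]
  left_equivariant := by
    have h := (δ.isColinear_unitMap (AlgHom.id R H)).mul (B.isColinear_convHom φ)
      (by rw [KleisliEnd.slide_one, LinearMap.id_comp, LinearMap.comp_id])
    rw [mul_one, RightComodule.unitMap_id, RightComodule.unitMap_id] at h
    rw [twirl_eq]
    exact (B.left.isColinear_iff β.toRightComodule.unit.val
      (δ.toRightComodule.unit.val * B.right.convHom φ)).1 h
  right_equivariant := by
    rw [twirl_eq]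
    apply B.right.equivariant_of_map_convHom_mul
    rw [map_convHom_mul_twist, map_twist_mul_convHom, (commute_push α hφ _).eq]

theorem unit_twist (δ : EquivariantCoaction β α B) (φ : WithConv (C →ₗ[R] H))
    (hφ : IsCocharacter α φ.ofConv) :
    (δ.twist φ hφ).toRightComodule.unit.val =
      δ.toRightComodule.unit.val * B.right.convHom φ :=
  KleisliEnd.ext (δ.twirl_eq φ)

/-- The right action of the group of cocharacters on the equivariant coactions. -/
instance : MulAction (cocharacterGroup α)ᵐᵒᵖ (EquivariantCoaction β α B) where
  smul φ δ := δ.twist φ.unop.val.val φ.unop.2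
  one_smul δ := by
    apply unit_injective
    refine (unit_twist _ _ _).trans ?_
    exact (congrArg _ (map_one B.right.convHom)).trans (mul_one _)
  mul_smul φ ψ δ := by
    apply unit_injective
    refine (unit_twist _ _ _).trans ((unit_twist _ _ _).trans ?_).symm
    refine (congrArg (· * _) (unit_twist _ _ _)).trans ((mul_assoc _ _ _).trans ?_)
    exact congrArg _ (map_mul B.right.convHom _ _).symm

theorem unit_smul (φ : cocharacterGroup α) (δ : EquivariantCoaction β α B) :
    (MulOpposite.op φ • δ).toRightComodule.unit.val =
      δ.toRightComodule.unit.val * B.right.convHom φ.val.val :=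
  unit_twist _ _ _

variable {δ₀ : EquivariantCoaction β α B}

theorem twist_injective
    (h₀ : δ₀.IsCoHom δ₀.asLeft (EquivariantLeftComodule.regular α) B.right.coact)
    (δ : EquivariantCoaction β α B) {φ ψ : WithConv (C →ₗ[R] H)}
    (h : δ.toRightComodule.unit.val * B.right.convHom φ =
      δ.toRightComodule.unit.val * B.right.convHom ψ) : φ = ψ :=
  convHom_injective h₀ ((Units.mul_right_inj _).1 h)

/-- Any two equivariant coactions differ by a twist, by the linear map that represents the
`D`-colinear map `δ⁻¹ δ'`. -/
theorem exists_twist_eq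
    (h₀ : δ₀.IsCoHom δ₀.asLeft (EquivariantLeftComodule.regular α) B.right.coact)
    (δ δ' : EquivariantCoaction β α B) : ∃ φ : WithConv (C →ₗ[R] H),
    δ'.toRightComodule.unit.val = δ.toRightComodule.unit.val * B.right.convHom φ := by
  have h := δ.isColinear_inv_mul_mul δ' (AlgHom.id R H) (LeftComodule.IsColinear.one B.left)
    (by rw [KleisliEnd.extend_one, lTensor_id, LinearMap.id_comp, LinearMap.comp_id])
  obtain ⟨φ, hφ⟩ := exists_convHom_eq h₀ h
  refine ⟨φ, ?_⟩
  rw [hφ, RightComodule.unitMap_id, RightComodule.unitMap_id, one_mul, Units.mul_inv_cancel_left]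

/-- A linear map that twists one equivariant coaction into another is a cocharacter: its defining
equations say that the twisted map is counital, coassociative and equivariant. -/
theorem isCocharacter_of_twist_eq
    (h₀ : δ₀.IsCoHom δ₀.asLeft (EquivariantLeftComodule.regular α) B.right.coact)
    {δ δ' : EquivariantCoaction β α B} {φ : WithConv (C →ₗ[R] H)}
    (h : δ'.toRightComodule.unit.val = δ.toRightComodule.unit.val * B.right.convHom φ) :
    IsCocharacter α φ.ofConv where
  counit_comp := by
    have h1 := (counit_iff δ'.toRightComodule.unit.val).1 δ'.counit
    rw [h, map_twist_counit, ← map_one B.right.convHom, ← toConv_counit] at h1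
    exact congrArg WithConv.ofConv (convHom_injective h₀ h1)
  coaction := by
    have h1 := (coassoc_iff δ'.toRightComodule.unit.val).1 δ'.coassoc
    rw [h, map_twist_mul_map_twist, map_twist_comul] at h1
    exact (coaction_iff α φ).2 (convHom_injective h₀ ((Units.mul_right_inj _).1 h1)).symm
  comodule := by
    have h1 := B.right.map_convHom_mul α δ'.toRightComodule.unit.val δ'.right_equivariant
      (toConv (TensorAlgebra.ι R (M := C)))
    rw [h, map_convHom_mul_twist, map_twist_mul_convHom] at h1
    exact (comodule_iff α φ).2 (convHom_injective h₀ ((Units.mul_right_inj _).1 h1))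

theorem smul_free
    (h₀ : δ₀.IsCoHom δ₀.asLeft (EquivariantLeftComodule.regular α) B.right.coact)
    {φ : cocharacterGroup α} {δ : EquivariantCoaction β α B}
    (h : MulOpposite.op φ • δ = δ) : φ = 1 := by
  have h1 := unit_smul φ δ
  rw [h] at h1
  apply Subtype.ext
  apply Units.ext
  refine twist_injective h₀ δ (h1.symm.trans ?_)
  exact ((congrArg _ (map_one B.right.convHom)).trans (mul_one _)).symm

theorem smul_transitive
    (h₀ : δ₀.IsCoHom δ₀.asLeft (EquivariantLeftComodule.regular α) B.right.coact)
    (δ δ' : EquivariantCoaction β α B) :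
    ∃ φ : cocharacterGroup α, MulOpposite.op φ • δ = δ' := by
  obtain ⟨φ, hφ⟩ := exists_twist_eq h₀ δ δ'
  obtain ⟨ψ, hψ⟩ := exists_twist_eq h₀ δ' δ
  have h1 : φ * ψ = 1 := by
    apply twist_injective h₀ δ
    rw [map_mul, ← mul_assoc, ← hφ, ← hψ, map_one, mul_one]
  have h2 : ψ * φ = 1 := by
    apply twist_injective h₀ δ'
    rw [map_mul, ← mul_assoc, ← hψ, ← hφ, map_one, mul_one]
  refine ⟨⟨⟨φ, ψ, h1, h2⟩, isCocharacter_of_twist_eq h₀ hφ⟩, unit_injective ?_⟩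
  exact (unit_smul _ _).trans hφ.symm

end EquivariantCoaction

end Twist

/-! ### Bicomodule automorphisms and inner cocharacters -/

section Automorphisms

variable {R : Type u} [CommRing R] {H : Type u} [Ring H] [HopfAlgebra R H]
  {C : Type u} [AddCommGroup C] [Module R C] [Coalgebra R C]
  {D : Type u} [AddCommGroup D] [Module R D] [Coalgebra R D]
  {M : Type u} [AddCommGroup M] [Module R M] {A : Type u} [Ring A] [Algebra R A]
  {β : HopfCoaction R H D} {α : HopfCoaction R H C} {B : Bicomodule R D C M}

namespace KleisliEnd

/-- The embedding `u ↦ (m ↦ u(m) ⊗ 1)` of `End(M)` in the Kleisli monoid. -/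
def ofEnd (A : Type u) [Ring A] [Algebra R A] : Module.End R M →* KleisliEnd R A M where
  toFun u := ⟨(TensorProduct.mk R M A).flip 1 ∘ₗ u⟩
  map_one' := rfl
  map_mul' u v := by
    ext1; ext m
    simp [toLin_mul, extend_tmul]

theorem toLin_ofEnd (u : Module.End R M) (m : M) : (ofEnd A u).toLin m = u m ⊗ₜ 1 := rfl

theorem extend_ofEnd (u : Module.End R M) : (ofEnd A u).extend = u.rTensor A := by
  ext m a
  simp [extend_tmul, toLin_ofEnd]

theorem map_ofEnd {A' : Type u} [Ring A'] [Algebra R A'] (j : A →ₐ[R] A')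
    (u : Module.End R M) : (ofEnd A u).map j = ofEnd A' u := by
  ext1; ext m
  simp [toLin_map, toLin_ofEnd]

theorem mul_ofEnd (k : KleisliEnd R A M) (u : Module.End R M) :
    (k * ofEnd A u).toLin = k.toLin ∘ₗ u := by
  ext m
  simp [toLin_mul, toLin_ofEnd, extend_tmul]

theorem ofEnd_mul (k : KleisliEnd R A M) (u : Module.End R M) :
    (ofEnd A u * k).toLin = u.rTensor A ∘ₗ k.toLin := by
  rw [toLin_mul, extend_ofEnd]

/-- Over the ground ring, the Kleisli monoid consists of the endomorphisms of `M`. -/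
theorem exists_ofEnd_eq (k : KleisliEnd R R M) : ∃ u : Module.End R M, ofEnd R u = k := by
  refine ⟨(TensorProduct.rid R M).toLinearMap ∘ₗ k.toLin, ?_⟩
  ext1; ext m
  apply (TensorProduct.rid R M).injective
  simp [toLin_ofEnd]

theorem ofEnd_injective : Function.Injective (ofEnd R : Module.End R M →* KleisliEnd R R M) := by
  intro u v h
  ext m
  have h1 := congrArg (TensorProduct.rid R M) (LinearMap.congr_fun (congrArg toLin h) m)
  simpa [toLin_ofEnd] using h1

end KleisliEnd

theorem LeftComodule.isHom_iff (l : LeftComodule R D M) (u : Module.End R M) :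
    l.IsHom l u ↔ l.IsColinear 1 (KleisliEnd.ofEnd R u) := by
  have h : ∀ t : D ⊗[R] M, TensorProduct.assoc R D M R (t ⊗ₜ 1) =
      (TensorProduct.rid R M).symm.toLinearMap.lTensor D t := by
    intro t
    induction t with
    | zero => simp
    | add x y hx hy => simp only [map_add, TensorProduct.add_tmul, hx, hy]
    | tmul x y => simp
  have hu : (KleisliEnd.ofEnd R u).toLin = (TensorProduct.rid R M).symm.toLinearMap ∘ₗ u := by
    ext m; simp [KleisliEnd.toLin_ofEnd]
  have hinj : Function.Injective ((TensorProduct.rid R M).symm.toLinearMap.lTensor D) :=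
    (LinearEquiv.lTensor D (TensorProduct.rid R M).symm).injective
  rw [IsHom, IsColinear, KleisliEnd.slide_one, LinearMap.id_comp, LinearMap.ext_iff,
    LinearMap.ext_iff]
  refine forall_congr' fun m => ?_
  rw [← hinj.eq_iff]
  simp only [LinearMap.comp_apply, tensorCoact, KleisliEnd.toLin_ofEnd, rTensor_tmul,
    LinearEquiv.coe_coe]
  rw [h, hu, lTensor_comp, LinearMap.comp_apply]

/-- Colinearity over `C` is a commutation rule over the tensor algebra of `C`. -/
theorem RightComodule.isHom_iff (ρ : RightComodule R C M) (u : Module.End R M) :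
    ρ.IsHom ρ u ↔ Commute (KleisliEnd.ofEnd (TensorAlgebra R C) u)
      (ρ.convHom (toConv (TensorAlgebra.ι R (M := C)))) := by
  have hι : TensorAlgebra.ιInv (R := R) (M := C) ∘ₗ TensorAlgebra.ι R (M := C) =
      LinearMap.id := LinearMap.ext TensorAlgebra.ι_leftInverse
  have hinj : Function.Injective ((TensorAlgebra.ι R (M := C)).lTensor M) := by
    refine Function.LeftInverse.injective
      (g := (TensorAlgebra.ιInv (R := R) (M := C)).lTensor M) fun t => ?_
    rw [← lTensor_comp_apply, hι, lTensor_id, LinearMap.id_apply]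
  rw [IsHom, commute_iff_eq, KleisliEnd.ext_iff, KleisliEnd.mul_ofEnd, KleisliEnd.ofEnd_mul,
    RightComodule.toLin_convHom, ← LinearMap.comp_assoc, rTensor_comp_lTensor,
    ← lTensor_comp_rTensor, LinearMap.comp_assoc, LinearMap.comp_assoc, eq_comm,
    LinearMap.ext_iff, LinearMap.ext_iff]
  exact forall_congr' fun m => hinj.eq_iff.symm

theorem RightComodule.map_ofId_convHom (ρ : RightComodule R C M) (f : WithConv (C →ₗ[R] R)) :
    (ρ.convHom f).map (Algebra.ofId R A) = ρ.convHom (convScalar R C A f) :=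
  ρ.map_convHom _ _

namespace EquivariantCoaction

theorem convHom_convScalar_mul_unit (δ : EquivariantCoaction β α B) (f : WithConv (C →ₗ[R] R)) :
    B.right.convHom (convScalar R C H f) * δ.toRightComodule.unit.val =
      δ.toRightComodule.unit.val * B.right.convHom (pushScalar α f) := by
  have h := congrArg (KleisliEnd.map (Algebra.TensorProduct.lid R H : R ⊗[R] H →ₐ[R] H))
    (δ.map_convHom_mul_unitMap f)
  have h1 : ((Algebra.TensorProduct.lid R H : R ⊗[R] H →ₐ[R] H)).comp
      Algebra.TensorProduct.includeRight = AlgHom.id R H := by ext; simp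
  have h2 : ((Algebra.TensorProduct.lid R H : R ⊗[R] H →ₐ[R] H)).comp
      Algebra.TensorProduct.includeLeft = Algebra.ofId R H := Subsingleton.elim _ _
  have h3 := congrArg Units.val (δ.map_unitMap Algebra.TensorProduct.includeRight
    (Algebra.TensorProduct.lid R H : R ⊗[R] H →ₐ[R] H))
  rw [h1, RightComodule.unitMap_id, Units.coe_map] at h3
  rw [map_mul, map_mul, KleisliEnd.map_map, h2, RightComodule.map_ofId_convHom,
    RightComodule.map_convHom] at h
  erw [h3] at h
  exact h

variable {δ₀ : EquivariantCoaction β α B}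

/-- Isomorphic coactions are those that differ by an inner cocharacter: the automorphisms of the
bicomodule `M` are the maps `m ↦ m₍₀₎ f(m₍₁₎)` with `f` an invertible cocentral functional. -/
theorem iso_iff (h₀ : δ₀.IsCoHom δ₀.asLeft (EquivariantLeftComodule.regular α) B.right.coact)
    (δ δ' : EquivariantCoaction β α B) : isoSetoid β α B δ δ' ↔
      ∃ f : (WithConv (C →ₗ[R] R))ˣ, IsCocentral f.val.ofConv ∧
        δ'.toRightComodule.unit.val =
          δ.toRightComodule.unit.val * B.right.convHom (innerCocharacter α f) := by
  -- the conjugate of `δ` by the automorphism of a functional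
  have key : ∀ (f : (WithConv (C →ₗ[R] R))ˣ) (u v : Module.End R M),
      B.right.convHom f.val = KleisliEnd.ofEnd R u →
      B.right.convHom (f⁻¹).val = KleisliEnd.ofEnd R v →
      u.rTensor H ∘ₗ δ.coact ∘ₗ v =
        (δ.toRightComodule.unit.val * B.right.convHom (innerCocharacter α f)).toLin := by
    intro f u v hu hv
    have hu' := congrArg (KleisliEnd.map (Algebra.ofId R H)) hu
    have hv' := congrArg (KleisliEnd.map (Algebra.ofId R H)) hv
    rw [RightComodule.map_ofId_convHom, KleisliEnd.map_ofEnd] at hu' hv'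
    rw [innerCocharacter, map_mul, ← mul_assoc, ← convHom_convScalar_mul_unit, hu', hv',
      KleisliEnd.mul_ofEnd, KleisliEnd.ofEnd_mul]
    rfl
  have central : ∀ (f : WithConv (C →ₗ[R] R)) (u : Module.End R M),
      B.right.convHom f = KleisliEnd.ofEnd R u →
      (B.right.IsHom B.right u ↔ IsCocentral f.ofConv) := by
    intro f u hu
    have hu' := congrArg (KleisliEnd.map (Algebra.ofId R (TensorAlgebra R C))) hu
    rw [RightComodule.map_ofId_convHom, KleisliEnd.map_ofEnd] at hu'
    rw [RightComodule.isHom_iff, isCocentral_iff, ← hu', commute_iff_eq, commute_iff_eq,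
      ← map_mul, ← map_mul, (convHom_injective h₀).eq_iff]
  constructor
  · rintro ⟨u, hl, hr, h⟩
    have huv : u.toLinearMap * u.symm.toLinearMap = (1 : Module.End R M) := by ext; simp
    have hvu : u.symm.toLinearMap * u.toLinearMap = (1 : Module.End R M) := by ext; simp
    have hl' : B.left.IsHom B.left u.symm.toLinearMap := by
      have h1 := ((B.left.isHom_iff _).1 hl).of_mul (k' := KleisliEnd.ofEnd R u.symm.toLinearMap) 1
        (Units.map (KleisliEnd.ofEnd R) ⟨_, _, huv, hvu⟩) (by
          change B.left.IsColinear 1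
            (KleisliEnd.ofEnd R u.toLinearMap * KleisliEnd.ofEnd R u.symm.toLinearMap)
          rw [← map_mul, huv, map_one]
          exact LeftComodule.IsColinear.one _)
      exact (B.left.isHom_iff _).2 h1
    obtain ⟨f, hf⟩ := exists_convHom_eq h₀ ((B.left.isHom_iff _).1 hl)
    obtain ⟨g, hg⟩ := exists_convHom_eq h₀ ((B.left.isHom_iff _).1 hl')
    refine ⟨⟨f, g, ?_, ?_⟩, (central f _ hf).1 hr, ?_⟩
    · apply convHom_injective h₀
      rw [map_mul, hf, hg, ← map_mul, huv, map_one, map_one]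
    · apply convHom_injective h₀
      rw [map_mul, hf, hg, ← map_mul, hvu, map_one, map_one]
    · exact KleisliEnd.ext (h.trans (key ⟨f, g, _, _⟩ _ _ hf hg))
  · rintro ⟨f, hf, h⟩
    obtain ⟨u, hu⟩ := KleisliEnd.exists_ofEnd_eq (B.right.convHom f.val)
    obtain ⟨v, hv⟩ := KleisliEnd.exists_ofEnd_eq (B.right.convHom (f⁻¹).val)
    have huv : u ∘ₗ v = LinearMap.id := KleisliEnd.ofEnd_injective (by
      refine (map_mul (KleisliEnd.ofEnd R) u v).trans ?_
      rw [hu, hv, ← map_mul, Units.mul_inv, map_one]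
      rfl)
    have hvu : v ∘ₗ u = LinearMap.id := KleisliEnd.ofEnd_injective (by
      refine (map_mul (KleisliEnd.ofEnd R) v u).trans ?_
      rw [hu, hv, ← map_mul, Units.inv_mul, map_one]
      rfl)
    refine ⟨LinearEquiv.ofLinearMap u v huv hvu, ?_, (central f.val u hu.symm).2 hf, ?_⟩
    · exact (B.left.isHom_iff u).2 (hu ▸ B.isColinear_convHom f.val)
    · exact (congrArg KleisliEnd.toLin h).trans (key f u v hu.symm hv.symm).symm

theorem iso_iff_smul
    (h₀ : δ₀.IsCoHom δ₀.asLeft (EquivariantLeftComodule.regular α) B.right.coact)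
    (δ δ' : EquivariantCoaction β α B) : isoSetoid β α B δ δ' ↔
      ∃ φ ∈ innerCocharacters α, δ' = MulOpposite.op φ • δ := by
  rw [iso_iff h₀]
  constructor
  · rintro ⟨f, hf, h⟩
    obtain ⟨φ, rfl⟩ := smul_transitive h₀ δ δ'
    exact ⟨φ, ⟨f, hf, twist_injective h₀ δ ((unit_smul φ δ).symm.trans h)⟩, rfl⟩
  · rintro ⟨φ, ⟨f, hf, h⟩, rfl⟩
    exact ⟨f, hf, by rw [unit_smul, h]⟩

end EquivariantCoaction

end Automorphisms

/-! ### Quotients of torsors -/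

/-- If `G` acts freely and transitively on `X` from the right, then the quotient of `G` by a normal
subgroup `N` acts freely and transitively on the set of `N`-orbits. -/
theorem exists_mulAction_quotient {G X : Type*} [Group G] [MulAction Gᵐᵒᵖ X] (N : Subgroup G)
    [N.Normal] (r : Setoid X) (hr : ∀ x y, r x y ↔ ∃ n ∈ N, y = MulOpposite.op n • x)
    (hfree : ∀ (g : G) (x : X), MulOpposite.op g • x = x → g = 1)
    (htrans : ∀ x y : X, ∃ g : G, MulOpposite.op g • x = y) :
    ∃ _ : MulAction (G ⧸ N)ᵐᵒᵖ (Quotient r),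
      (∀ (g : G) (x : X), MulOpposite.op (g : G ⧸ N) • (Quotient.mk r x) =
        Quotient.mk r (MulOpposite.op g • x)) ∧
      (∀ (s : G ⧸ N) (x : Quotient r), MulOpposite.op s • x = x → s = 1) ∧
      (∀ x y : Quotient r, ∃ s : G ⧸ N, MulOpposite.op s • x = y) := by
  have hwd : ∀ (g g' : G) (x x' : X), g⁻¹ * g' ∈ N → r x x' →
      r (MulOpposite.op g • x) (MulOpposite.op g' • x') := by
    intro g g' x x' hg hx
    obtain ⟨n, hn, rfl⟩ := (hr _ _).1 hx
    refine (hr _ _).2 ⟨g⁻¹ * n * g * (g⁻¹ * g'), N.mul_mem ?_ hg, ?_⟩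
    · simpa using Subgroup.Normal.conj_mem ‹_› n hn g⁻¹
    · rw [smul_smul, smul_smul, ← MulOpposite.op_mul, ← MulOpposite.op_mul]
      congr 2
      group
  let act : G ⧸ N → Quotient r → Quotient r := fun s x =>
    Quotient.liftOn₂' s x (fun g x => Quotient.mk r (MulOpposite.op g • x))
      fun g x g' x' hg hx => Quotient.sound (hwd g g' x x' (QuotientGroup.leftRel_apply.1 hg) hx)
  have hact : ∀ (g : G) (x : X), act (g : G ⧸ N) (Quotient.mk r x) =
      Quotient.mk r (MulOpposite.op g • x) := fun _ _ => rfl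
  refine ⟨{ smul := fun s x => act s.unop x, one_smul := ?_, mul_smul := ?_ }, hact, ?_, ?_⟩
  · rintro ⟨⟨g⟩⟩ ⟨⟨h⟩⟩ ⟨x⟩
    refine (hact (h * g) x).trans ?_
    rw [MulOpposite.op_mul, mul_smul]
    rfl
  · rintro ⟨x⟩
    refine (hact 1 x).trans ?_
    rw [MulOpposite.op_one, one_smul]
    rfl
  · rintro ⟨g⟩ ⟨x⟩ h
    obtain ⟨n, hn, hx⟩ := (hr _ _).1 (Quotient.exact h)
    -- `x = x g n`, so `g` is the inverse of an element of `N`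
    rw [smul_smul, ← MulOpposite.op_mul] at hx
    have h1 := eq_inv_of_mul_eq_one_left (hfree _ _ hx.symm)
    refine (QuotientGroup.eq_one_iff g).2 ?_
    rw [h1]
    exact N.inv_mem hn
  · rintro ⟨x⟩ ⟨y⟩
    obtain ⟨g, rfl⟩ := htrans x y
    exact ⟨g, rfl⟩

end

end HopfEquivariant

theorem mainTheorem1 {R : Type u} [CommRing R] {H : Type u} [Ring H] [HopfAlgebra R H]
    {C : Type u} [AddCommGroup C] [Module R C] [Coalgebra R C]
    {D : Type u} [AddCommGroup D] [Module R D] [Coalgebra R D]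
    {M : Type u} [AddCommGroup M] [Module R M]
    (α : HopfEquivariant.HopfCoaction R H C) (β : HopfEquivariant.HopfCoaction R H D)
    (B : HopfEquivariant.Bicomodule R D C M)
    (δ₀ : HopfEquivariant.EquivariantCoaction β α B) (hδ₀ : δ₀.IsMoritaTakeuchi) :
    ∃ _ : MulAction (HopfEquivariant.cocharacterGroup α)ᵐᵒᵖ
        (HopfEquivariant.EquivariantCoaction β α B),
      (∀ (φ : HopfEquivariant.cocharacterGroup α) (δ : HopfEquivariant.EquivariantCoaction β α B),
        (MulOpposite.op φ • δ).coact = δ.twirl φ.val.val.ofConv) ∧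
      (∀ (φ : HopfEquivariant.cocharacterGroup α) (δ : HopfEquivariant.EquivariantCoaction β α B),
        MulOpposite.op φ • δ = δ → φ = 1) ∧
      (∀ δ δ' : HopfEquivariant.EquivariantCoaction β α B,
        ∃ φ : HopfEquivariant.cocharacterGroup α, MulOpposite.op φ • δ = δ') ∧
      ∃ _ : MulAction (HopfEquivariant.FirstHomoschism α)ᵐᵒᵖ
          (HopfEquivariant.EquivariantCoaction.IsoClasses β α B),
        (∀ (φ : HopfEquivariant.cocharacterGroup α)
          (δ : HopfEquivariant.EquivariantCoaction β α B),
          MulOpposite.op (φ : HopfEquivariant.FirstHomoschism α) •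
            (Quotient.mk _ δ : HopfEquivariant.EquivariantCoaction.IsoClasses β α B) =
          Quotient.mk _ (MulOpposite.op φ • δ)) ∧
        (∀ (s : HopfEquivariant.FirstHomoschism α)
          (x : HopfEquivariant.EquivariantCoaction.IsoClasses β α B),
          MulOpposite.op s • x = x → s = 1) ∧
        (∀ x y : HopfEquivariant.EquivariantCoaction.IsoClasses β α B,
          ∃ s : HopfEquivariant.FirstHomoschism α, MulOpposite.op s • x = y) := by
  have h₀ := HopfEquivariant.EquivariantCoaction.isCoHom_regular hδ₀.quasiFinite hδ₀.coEnd
  refine ⟨inferInstance, fun φ δ => rfl,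
    fun φ δ h => HopfEquivariant.EquivariantCoaction.smul_free h₀ h,
    HopfEquivariant.EquivariantCoaction.smul_transitive h₀, ?_⟩
  exact HopfEquivariant.exists_mulAction_quotient (HopfEquivariant.innerCocharacters α) _
    (HopfEquivariant.EquivariantCoaction.iso_iff_smul h₀)
    (fun φ δ h => HopfEquivariant.EquivariantCoaction.smul_free h₀ h)
    (HopfEquivariant.EquivariantCoaction.smul_transitive h₀)
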